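/- Let $(R,\mathfrak m)$ be a complete Noetherian local ring that is Gorenstein, i.e. $R$ has finite injective dimension as a module over itself. A system of parameters of $R$ is a sequence $x_1,\dots,x_d$, $d=\dim R$, such that $\sqrt{(x_1,\dots,x_d)}=\mathfrak m$. (0) A closure operation $\mathrm{cl}$ on finitely generated $R$-modules assigns to each submodule $L$ of a finitely generated $R$-module $M$ a submodule $L\subseteq L^{\mathrm{cl}}_M\subseteq M$, such that $(L^{\mathrm{cl}}_M)^{\mathrm{cl}}_M=L^{\mathrm{cl}}_M$, and $L^{\mathrm{cl}}_M\subseteq N^{\mathrm{cl}}_M$ whenever $L\subseteq N\subseteq M$. It is functorial if $g(L^{\mathrm{cl}}_M)\subseteq g(L)^{\mathrm{cl}}_N$ for all $R$-linear $g:M\to N$, and residual if $(\ker q)^{\mathrm{cl}}_M=q^{-1}(0^{\mathrm{cl}}_P)$ for all surjective $R$-linear $q:M\to P$. Let $\mathrm{cl}$ be a functorial and residual closure operation. If there is a system of parameters $x_1,\dots,x_d$ of $R$ such that the ideal $(x_1^t,\dots,x_d^t)$ is $\mathrm{cl}$-closed in $R$ for infinitely many $t\in\mathbb N$, then $I^{\mathrm{cl}}_R=I$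 for every ideal $I$ of $R$, and $0^{\mathrm{cl}}_M=0$ for every finitely generated $R$-module $M$. (1) If $R$ is equicharacteristic and $F$-rational, then it is $F$-regular. Explicitly: (1a) Let $R$ have prime characteristic $p$. For an ideal $I$ of a Noetherian ring $S$ of characteristic $p$, the tight closure $I^*$ is the set of all $u\in S$ for which there is $c\in S$ outside every minimal prime of $S$ with $cu^{q}\in I^{[q]}=(a^q: a\in I)$ for all sufficiently large powers $q$ of $p$. If every ideal of $R$ generated by a system of parameters is tightly closed ($R$ is $F$-rational), then every ideal of $R$ and of each localization $R_P$, $P\in\operatorname{Spec}R$, is tightly closed ($R$ is $F$-regular). (1b) Let $K$ be a field of characteristic $0$ and let $R$ be a $K$-algebra. For an ideal $I$ of a $K$-algebra $C$, let $I^{>*K}$ be the set of all $w\in C$ for which there are a finitely generated subring $A\subseteq K$, an $A$-algebra $D$ of finite type, an $A$-algebra homomorphism $\varphi:D\to C$, an ideal $J\subseteq D$ and $t\in D$ with $JC=I$ and $\varphi(t)=w$, and some $0\neq a\in A$ such that for all maximal ideals $\mu\not\ni a$ of $A$, the image of $t$ in $D/\mu D$ lies in the (characteristic $p=\operatorname{char}A/\mu$)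 tight closure of $J(D/\mu D)$. The tight closure of an ideal $I$ of $R$ is the set of all $w\in R$ whose image in $R/P$ lies in $(I(R/P))^{>*K}$ for every minimal prime $P$ of $R$ (the $K$-tight closure of Hochster and Huneke; equational tight closure if $K=\mathbb Q$). If every ideal of $R$ generated by a system of parameters is tightly closed in this sense ($R$ is $F$-rational), then every ideal of $R$ is tightly closed in this sense ($R$ is $F$-regular). (2) Let $R$ have prime characteristic $p$ and be $F$-injective, i.e. the Frobenius map $R\to F_*R$ (where $F_*R$ is $R$ as an $R$-module via $a\mapsto a^p$) induces injective maps $H^i_{\mathfrak m}(R)\to H^i_{\mathfrak m}(F_*R)$ for all $i\ge 0$. Then $R$ is $F$-pure, i.e. $M\otimes_R R\to M\otimes_R F_*R$ is injective for every $R$-module $M$. -/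

import Mathlib

open CategoryTheory TensorProduct

universe u v

namespace FSing

/-! ### Gorenstein rings and systems of parameters -/

/-- A local ring is Gorenstein if it has finite injective dimension as a module over itself.
(Used for Noetherian local rings.) -/
def IsGorensteinLocal (R : Type u) [CommRing R] [IsLocalRing R] : Prop :=
  ∃ n : ℕ, HasInjectiveDimensionLE (ModuleCat.of.{u} R R) n

/-- A system of parameters of a local ring: `d = dim R` elements generating an ideal whose
radical is the maximal ideal. -/
def IsSystemOfParameters (R : Type u) [CommRing R] [IsLocalRing R] {d : ℕ} (x : Fin d → R) :
    Prop :=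
  ringKrullDim R = d ∧ (Ideal.span (Set.range x)).radical = IsLocalRing.maximalIdeal R

/-! ### Closure operations on finitely generated modules -/

/-- A closure operation on submodules of finitely generated `R`-modules. -/
structure ClosureOperation (R : Type u) [CommRing R] where
  /-- The closure of the submodule `L` in the ambient module `M`. -/
  cl : ∀ (M : Type u) [AddCommGroup M] [Module R M] [Module.Finite R M],
    Submodule R M → Submodule R M
  le_cl : ∀ (M : Type u) [AddCommGroup M] [Module R M] [Module.Finite R M]
    (L : Submodule R M), L ≤ cl M L
  cl_cl : ∀ (M : Type u) [AddCommGroup M] [Module R M] [Module.Finite R M]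
    (L : Submodule R M), cl M (cl M L) = cl M L
  cl_mono : ∀ (M : Type u) [AddCommGroup M] [Module R M] [Module.Finite R M]
    (L N : Submodule R M), L ≤ N → cl M L ≤ cl M N

/-- `g(L^cl_M) ⊆ g(L)^cl_N` for every linear map `g : M → N`. -/
def ClosureOperation.Functorial {R : Type u} [CommRing R] (c : ClosureOperation R) : Prop :=
  ∀ (M N : Type u) [AddCommGroup M] [Module R M] [Module.Finite R M]
    [AddCommGroup N] [Module R N] [Module.Finite R N] (g : M →ₗ[R] N) (L : Submodule R M),
    (c.cl M L).map g ≤ c.cl N (L.map g)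

/-- `(ker q)^cl_M = q⁻¹(0^cl_P)` for every surjective linear map `q : M → P`. -/
def ClosureOperation.Residual {R : Type u} [CommRing R] (c : ClosureOperation R) : Prop :=
  ∀ (M P : Type u) [AddCommGroup M] [Module R M] [Module.Finite R M]
    [AddCommGroup P] [Module R P] [Module.Finite R P] (q : M →ₗ[R] P),
    Function.Surjective q → c.cl M (LinearMap.ker q) = (c.cl P ⊥).comap q

/-! ### Tight closure in prime characteristic -/

/-- The bracket power `I^[q]`, generated by the `q`-th powers of the elements of `I`. -/
def bracketPower {S : Type*} [CommRing S] (I : Ideal S) (q : ℕ) : Ideal S :=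
  Ideal.span ((fun a => a ^ q) '' (I : Set S))

/-- The tight closure of an ideal in a Noetherian ring `S` of prime characteristic `p`:
`u ∈ I^*` iff there is `c` outside all minimal primes of `S` with `c u^q ∈ I^[q]` for all
large powers `q` of `p`. -/
def tightClosure (p : ℕ) {S : Type*} [CommRing S] (I : Ideal S) : Set S :=
  {u | ∃ c : S, (∀ P ∈ minimalPrimes S, c ∉ P) ∧
    ∃ e₀ : ℕ, ∀ e : ℕ, e₀ ≤ e → c * u ^ p ^ e ∈ bracketPower I (p ^ e)}

/-- A local ring of characteristic `p` is `F`-rational if every ideal generated by a system of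
parameters is tightly closed. -/
def IsFRational (p : ℕ) (R : Type u) [CommRing R] [IsLocalRing R] : Prop :=
  ∀ (d : ℕ) (x : Fin d → R), IsSystemOfParameters R x →
    tightClosure p (Ideal.span (Set.range x)) = (Ideal.span (Set.range x) : Set R)

/-- A ring of characteristic `p` is `F`-regular if every ideal of it and of all its
localizations at primes is tightly closed. -/
def IsFRegular (p : ℕ) (R : Type u) [CommRing R] : Prop :=
  (∀ I : Ideal R, tightClosure p I = (I : Set R)) ∧
  ∀ (P : Ideal R) [P.IsPrime] (I : Ideal (Localization.AtPrime P)),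
    tightClosure p I = (I : Set (Localization.AtPrime P))

/-! ### Tight closure in equal characteristic zero -/

/-- The direct `K`-tight closure of an ideal `I` in an algebra `C` over a field `K` of
characteristic zero: `w` is in it if the pair `(I, w)` is the image of a pair `(J, t)` in an algebra
`D` of finite type over a finitely generated subring `A` of `K`, such that on the fibre `D/μD`
over each closed point `μ` of a nonempty open subset `{a ≠ 0}` of `Spec A`, `t` is in
the (characteristic `p`) tight closure of `J`. Here `p` is the characteristic of `A/μ`. -/
def directTightClosure (K : Type v) [Field K] {C : Type u} [CommRing C] [Algebra K C]
    (I : Ideal C) : Set C :=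
  {w | ∃ (A : Subalgebra ℤ K) (_ : A.FG) (D : Type) (_ : CommRing D) (_ : Algebra A D)
    (_ : Algebra.FiniteType A D) (φ : D →ₐ[A] C) (J : Ideal D) (t : D),
    J.map φ = I ∧ φ t = w ∧
    ∃ a : A, a ≠ 0 ∧ ∀ μ : Ideal A, μ.IsMaximal → a ∉ μ →
      ∀ p : ℕ, p.Prime → (p : A) ∈ μ →
        Ideal.Quotient.mk (μ.map (algebraMap A D)) t ∈
          tightClosure p (J.map (Ideal.Quotient.mk (μ.map (algebraMap A D))))}

/-- The `K`-tight closure of an ideal `I` of a complete Noetherian local `K`-algebra `R`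
(`K` a field of characteristic zero): the elements whose image in every complete local domain `R/P`,
`P` a minimal prime, is in the direct `K`-tight closure of the image of `I`.
For `K = ℚ` this is equational tight closure. -/
def zeroTightClosure (K : Type v) [Field K] {R : Type u} [CommRing R] [Algebra K R]
    (I : Ideal R) : Set R :=
  {w | ∀ P ∈ minimalPrimes R,
    Ideal.Quotient.mk P w ∈ directTightClosure K (I.map (Ideal.Quotient.mk P))}

/-- `F`-rationality of a complete local ring over a field `K` of characteristic zero: every ideal
generated by a system of parameters is tightly closed. -/
def IsFRationalZero (K : Type v) [Field K] (R : Type u) [CommRing R] [IsLocalRing R]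
    [Algebra K R] : Prop :=
  ∀ (d : ℕ) (x : Fin d → R), IsSystemOfParameters R x →
    zeroTightClosure K (Ideal.span (Set.range x)) = (Ideal.span (Set.range x) : Set R)

/-- `F`-regularity of a complete local ring over a field `K` of characteristic zero: every ideal is
tightly closed. -/
def IsFRegularZero (K : Type v) [Field K] (R : Type u) [CommRing R] [Algebra K R] : Prop :=
  ∀ I : Ideal R, zeroTightClosure K I = (I : Set R)

/-! ### `F`-injectivity and `F`-purity -/

/-- `F_*R`: the ring `R` regarded as an `R`-module by restriction of scalars along Frobenius. -/
def FrobeniusPushforward (_p : ℕ) (R : Type u) : Type u := R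

instance (p : ℕ) (R : Type u) [CommRing R] : AddCommGroup (FrobeniusPushforward p R) :=
  inferInstanceAs (AddCommGroup R)

instance (p : ℕ) [Fact p.Prime] (R : Type u) [CommRing R] [CharP R p] :
    Module R (FrobeniusPushforward p R) :=
  Module.compHom R (frobenius R p)

/-- The Frobenius as an `R`-linear map `R → F_*R`, `a ↦ a ^ p`. -/
def frobeniusLinear (p : ℕ) [Fact p.Prime] (R : Type u) [CommRing R] [CharP R p] :
    R →ₗ[R] FrobeniusPushforward p R where
  toFun := frobenius R p
  map_add' := map_add (frobenius R p)
  map_smul' := map_mul (frobenius R p)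

/-- `R` is `F`-injective if Frobenius induces an injective map
`H^i_𝔪(R) → H^i_𝔪(F_*R) = F_*H^i_𝔪(R)` for every `i`. -/
def IsFInjective (p : ℕ) [Fact p.Prime] (R : Type u) [CommRing R] [IsLocalRing R]
    [CharP R p] : Prop :=
  ∀ i : ℕ, Function.Injective
    ((localCohomology (IsLocalRing.maximalIdeal R) i).map
      (ModuleCat.ofHom (frobeniusLinear p R))).hom

/-- `R` is `F`-pure if Frobenius `R → F_*R` is pure, i.e. stays injective after tensoring
with any module. -/
def IsFPure (p : ℕ) [Fact p.Prime] (R : Type u) [CommRing R] [CharP R p] : Prop :=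
  ∀ (M : Type u) [AddCommGroup M] [Module R M],
    Function.Injective (LinearMap.lTensor M (frobeniusLinear p R))

end FSing

/-! Everything rests on one fact. Over a Gorenstein local ring with system of parameters x, a
nonzero element m of a finitely generated module M has nonzero image under some linear map M →
R/(x₁ᵗ, …, x_dᵗ), where t can be taken from any prescribed infinite set
(`exists_linearMap_quotient_pow`). By Krull's intersection theorem m survives in M/(xᵗ)M for large
t, and R/(xᵗ) is self-injective. Self-injectivity comes from Rees's isomorphism Hom(N, R/(x)) ≅
Ext^d(N, R) for N killed by the regular sequence x (`exists_universal_ext`), together with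
Ext^{d+1}(-, R) = 0 on finite modules. That systems of parameters are regular and that d bounds the
injective dimension is deduced from finite injective dimension by Nakayama, prime filtrations and
depth estimates.

A closure respected by linear maps is therefore trivial once it fixes infinitely many (xᵗ). A linear
map R/I → R/J is multiplication by some y with yI ⊆ J, so for tight closure only y·I^* ⊆ J^* must be
checked. In characteristic p this is immediate. In characteristic zero polynomial variables mapping
to y and to generators of J are adjoined to the model D, and the fibres only become polynomial
rings.

For F-regularity of R_P, a maximal regular sequence in P becomes a system of parameters of R_P,
because quotients of R by regular sequences are unmixed. A single s ∉ P whose q-th power clears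
denominators modulo (x^q), for all q at once, brings tight closure relations from R_P back to R.

For F-purity, Rees's class in Ext^d(R/(x), R) yields a class in the top local cohomology of R whose
annihilator is exactly (x). Pushing it along Frobenius shows that F(a) ∈ (x)F_*R implies a ∈ (x),
and maps to R/(xᵗ) carry this over to arbitrary modules. Local cohomology is a colimit of `Ext`
groups defined by derived functors, while the computations use `Abelian.Ext`; the two are compared
through cocycles on projective resolutions. -/

namespace FSing

open Abelian RingTheory.Sequence IsLocalRing

/-! ### Ext modules and regular sequences -/

section ExtRegular

variable {R : Type u} [CommRing R]

/-- A scalar that annihilates `N` annihilates `Ext N M i`. -/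
theorem smul_ext_eq_zero {N M : ModuleCat.{u} R} {r : R} (hr : ∀ n : N, r • n = 0) {i : ℕ}
    (x : Abelian.Ext N M i) : r • x = 0 := by
  have h : r • 𝟙 N = 0 := by
    ext n
    exact hr n
  have : r • x = (Ext.mk₀ (r • 𝟙 N)).comp x (zero_add i) := by simp [Ext.mk₀_smul]
  rw [this, h, Ext.mk₀_zero, Ext.zero_comp]

/-- The connecting class of `0 → M → M → M / r M → 0` and the exactness of the associated
sequences. -/
theorem exists_ext_quotSMulTop (M : ModuleCat.{u} R) {r : R} (reg : IsSMulRegular M r) :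
    ∃ δ : Abelian.Ext (ModuleCat.of R (QuotSMulTop r M)) M 1,
      (∀ (N : ModuleCat.{u} R) (i : ℕ) (y : Abelian.Ext N (ModuleCat.of R (QuotSMulTop r M)) i),
        y.comp δ rfl = 0 → ∃ (g : M ⟶ ModuleCat.of R (QuotSMulTop r M)) (x : Abelian.Ext N M i),
          x.comp (Ext.mk₀ g) (add_zero i) = y) ∧
      ∀ (N : ModuleCat.{u} R) (i : ℕ) (x : Abelian.Ext N M (i + 1)), r • x = 0 →
        ∃ y : Abelian.Ext N (ModuleCat.of R (QuotSMulTop r M)) i, y.comp δ rfl = x := by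
  have hS := reg.smulShortComplex_shortExact
  refine ⟨hS.extClass, fun N i y hy => ?_, fun N i x hx => ?_⟩
  · obtain ⟨x, hx⟩ := Ext.covariant_sequence_exact₃ N hS y rfl hy
    exact ⟨_, x, hx⟩
  · rw [Ext.smul_eq_comp_mk₀] at hx
    exact Ext.covariant_sequence_exact₁ N hS x hx rfl

/-- For a weakly `M`-regular sequence `rs` there is a class in `Ext (M / rs M) M` through which
all top extension classes of modules killed by `rs` factor uniquely, and lower extensions of
such modules vanish. -/
theorem exists_universal_ext (M : ModuleCat.{u} R) (rs : List R) (reg : IsWeaklyRegular M rs) :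
    (∀ N : ModuleCat.{u} R, (∀ r ∈ rs, ∀ n : N, r • n = 0) →
      ∀ i < rs.length, Subsingleton (Abelian.Ext N M i)) ∧
    ∃ η : Abelian.Ext (ModuleCat.of R (M ⧸ Ideal.ofList rs • (⊤ : Submodule R M))) M rs.length,
      ∀ N : ModuleCat.{u} R, (∀ r ∈ rs, ∀ n : N, r • n = 0) →
        Function.Bijective
          (fun φ : N ⟶ ModuleCat.of R (M ⧸ Ideal.ofList rs • (⊤ : Submodule R M)) =>
            (Ext.mk₀ φ).comp η (zero_add _)) := by
  induction rs generalizing M with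
  | nil =>
    refine ⟨fun N _ i hi => absurd hi (Nat.not_lt_zero i), ?_⟩
    let e : ModuleCat.of R (M ⧸ Ideal.ofList ([] : List R) • (⊤ : Submodule R M)) ≅ M :=
      (Submodule.quotEquivOfEqBot _ (by simp)).toModuleIso
    refine ⟨Ext.mk₀ e.hom, fun N _ => ?_⟩
    have h : (fun φ : N ⟶ ModuleCat.of R (M ⧸ Ideal.ofList ([] : List R) • (⊤ : Submodule R M)) =>
        (Ext.mk₀ φ).comp (Ext.mk₀ e.hom) (zero_add _)) = fun φ => Ext.mk₀ (φ ≫ e.hom) := by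
      funext φ
      exact Ext.mk₀_comp_mk₀ _ _
    change Function.Bijective (fun φ : N ⟶ _ => (Ext.mk₀ φ).comp (Ext.mk₀ e.hom) (zero_add _))
    rw [h]
    exact (Ext.mk₀_bijective N M).comp ⟨fun a b hab => by simpa using hab,
      fun b => ⟨b ≫ e.inv, by simp⟩⟩
  | cons r rs ih =>
    rw [isWeaklyRegular_cons_iff] at reg
    obtain ⟨δ, hδ₁, hδ₂⟩ := exists_ext_quotSMulTop M reg.1
    obtain ⟨ihv, η, hη⟩ := ih (ModuleCat.of R (QuotSMulTop r M)) reg.2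
    have van : ∀ N : ModuleCat.{u} R, (∀ s ∈ r :: rs, ∀ n : N, s • n = 0) →
        ∀ i < (r :: rs).length, Subsingleton (Abelian.Ext N M i) := by
      intro N hN i hi
      refine subsingleton_of_forall_eq 0 fun x => ?_
      have hx : r • x = 0 := smul_ext_eq_zero (hN r (by simp)) x
      -- In degree 0 regularity of `r` forces the class to vanish; in degree i + 1 the class comes
      -- through `δ` from Ext^i(N, M/rM), which is zero by induction.
      match i with
      | 0 =>
        obtain ⟨f, rfl⟩ := (Ext.mk₀_bijective N M).2 x
        rw [← Ext.mk₀_smul, ← Ext.mk₀_zero, (Ext.mk₀_bijective N M).1.eq_iff] at hx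
        have : f = 0 := by
          ext n
          apply reg.1
          refine (congrArg (fun g : N ⟶ M => g.hom n) hx).trans ?_
          exact (smul_zero r).symm
        rw [this, Ext.mk₀_zero]
      | i + 1 =>
        obtain ⟨y, rfl⟩ := hδ₂ N i x hx
        have := ihv N (fun s hs => hN s (by simp [hs])) i (by simpa using hi)
        rw [Subsingleton.elim y 0, Ext.zero_comp]
    refine ⟨van, ?_⟩
    let e : ModuleCat.of R (M ⧸ Ideal.ofList (r :: rs) • (⊤ : Submodule R M)) ≅
        ModuleCat.of R (QuotSMulTop r M ⧸ Ideal.ofList rs • (⊤ : Submodule R (QuotSMulTop r M))) :=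
      (Submodule.quotOfListConsSMulTopEquivQuotSMulTopInner M r rs).toModuleIso
    -- The class for M/rM is followed by the connecting class. Composition with `δ` is injective
    -- since Ext(N, M) vanishes one degree lower, and surjective since `r` kills Ext(N, M).
    refine ⟨(Ext.mk₀ e.hom).comp (η.comp δ rfl) (zero_add _), fun N hN => ?_⟩
    have hb := hη N (fun s hs => hN s (by simp [hs]))
    have key : (fun φ : N ⟶ ModuleCat.of R (M ⧸ Ideal.ofList (r :: rs) • (⊤ : Submodule R M)) =>
        (Ext.mk₀ φ).comp ((Ext.mk₀ e.hom).comp (η.comp δ rfl) (zero_add _))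
          (zero_add _)) =
        (fun y : Abelian.Ext N (ModuleCat.of R (QuotSMulTop r M)) rs.length =>
          (y.comp δ rfl : Abelian.Ext N M (rs.length + 1))) ∘
        (fun φ => (Ext.mk₀ φ).comp η (zero_add _)) ∘ (fun φ => φ ≫ e.hom) := by
      funext φ
      simp only [Function.comp_apply]
      rw [← Ext.comp_assoc _ _ _ (zero_add 0) (zero_add _) (by simp), Ext.mk₀_comp_mk₀,
        ← Ext.comp_assoc _ _ _ (zero_add _) rfl (by simp)]
    rw [key]
    refine Function.Bijective.comp ?_ (hb.comp ⟨fun a b hab => by simpa using hab,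
      fun b => ⟨b ≫ e.inv, by simp⟩⟩)
    constructor
    · have inj : ∀ y : Abelian.Ext N (ModuleCat.of R (QuotSMulTop r M)) rs.length,
          (y.comp δ rfl : Abelian.Ext N M (rs.length + 1)) = 0 → y = 0 := by
        intro y hy
        obtain ⟨g, x, rfl⟩ := hδ₁ N _ y hy
        have := van N hN rs.length (by simp)
        rw [Subsingleton.elim x 0, Ext.zero_comp]
      intro a b hab
      rw [← sub_eq_zero]
      apply inj
      rw [sub_eq_add_neg, Ext.add_comp, Ext.neg_comp, ← sub_eq_add_neg, sub_eq_zero]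
      exact hab
    · intro x
      exact hδ₂ N _ x (smul_ext_eq_zero (hN r (by simp)) x)

end ExtRegular

/-! ### Bounding the injective dimension of R by the length of a regular sequence -/

section LocalVanishing

variable {R : Type u} [CommRing R] [IsLocalRing R] [IsNoetherianRing R]

/-- All extensions of finite modules by `R` vanish in degrees at least `n`. -/
def ExtVanishing (R : Type u) [CommRing R] (n : ℕ) : Prop :=
  ∀ N : ModuleCat.{u} R, Module.Finite R N → ∀ i, n ≤ i →
    Subsingleton (Abelian.Ext N (ModuleCat.of R R) i)

open scoped Pointwise in
/-- Top-degree extensions of `R ⧸ P` by `R` vanish when `P` is a non-maximal prime. -/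
theorem subsingleton_ext_quotient_prime {n : ℕ} (hV : ExtVanishing R (n + 1)) (P : Ideal R)
    [P.IsPrime] (hP : P ≠ maximalIdeal R) :
    Subsingleton (Abelian.Ext (ModuleCat.of R (R ⧸ P)) (ModuleCat.of R R) n) := by
  obtain ⟨x, hxm, hxP⟩ : ∃ x ∈ maximalIdeal R, x ∉ P := by
    by_contra! h
    exact hP (le_antisymm (le_maximalIdeal Ideal.IsPrime.ne_top') h)
  have reg : IsSMulRegular (ModuleCat.of R (R ⧸ P)) x := by
    rw [isSMulRegular_iff_right_eq_zero_of_smul]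
    intro a ha
    obtain ⟨a, rfl⟩ := Ideal.Quotient.mk_surjective a
    have h2 : (Ideal.Quotient.mk P) (x * a) = 0 := ha
    rw [Ideal.Quotient.eq_zero_iff_mem] at h2 ⊢
    exact (Ideal.IsPrime.mem_or_mem ‹_› h2).resolve_left hxP
  have hS := reg.smulShortComplex_shortExact
  by_contra hns
  rw [not_subsingleton_iff_nontrivial] at hns
  have hmem : x ∈ (Module.annihilator R
      (Abelian.Ext (ModuleCat.of R (R ⧸ P)) (ModuleCat.of R R) n)).jacobson :=
    IsLocalRing.maximalIdeal_le_jacobson _ hxm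
  -- Nakayama: since Ext^{n+1}(R/(P, x), R) = 0, multiplication by x is onto on the finitely
  -- generated module Ext^n(R/P, R).
  refine Submodule.top_ne_pointwise_smul_of_mem_jacobson_annihilator hmem ?_
  rw [eq_comm, eq_top_iff]
  intro y _
  have hz : Subsingleton (Abelian.Ext (ModuleCat.of R (QuotSMulTop x (R ⧸ P)))
      (ModuleCat.of R R) (n + 1)) := hV _ (by dsimp; infer_instance) _ le_rfl
  obtain ⟨z, rfl⟩ := Ext.contravariant_sequence_exact₁ hS (ModuleCat.of R R) y (add_comm 1 n)
    (hz.elim _ _)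
  have : ∀ z : Abelian.Ext (ModuleCat.of R (R ⧸ P)) (ModuleCat.of R R) n,
      (Ext.mk₀ (x • 𝟙 (ModuleCat.of R (R ⧸ P)))).comp z (zero_add n) = x • z := by
    intro z
    simp [Ext.mk₀_smul]
  refine Eq.subst (motive := fun w => w ∈ x • (⊤ : Submodule R _)) (this z).symm ?_
  exact Submodule.smul_mem_pointwise_smul _ _ ⊤ trivial

/-- If top-degree extensions of the residue field vanish, then so do those of every finite
module. -/
theorem ExtVanishing.of_residueField {n : ℕ} (hV : ExtVanishing R (n + 1))
    (hk : Subsingleton (Abelian.Ext (ModuleCat.of R (R ⧸ maximalIdeal R)) (ModuleCat.of R R) n)) :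
    ExtVanishing R n := by
  have main : ∀ (N : Type u) [AddCommGroup N] [Module R N] [Module.Finite R N],
      Subsingleton (Abelian.Ext (ModuleCat.of R N) (ModuleCat.of R R) n) := by
    intro N _ _ hN
    -- Dévissage along a prime filtration; only the factors isomorphic to the residue field need the
    -- hypothesis `hk`.
    refine IsNoetherianRing.induction_on_isQuotientEquivQuotientPrime R hN
      (motive := fun N _ _ _ => Subsingleton (Abelian.Ext (ModuleCat.of R N) (ModuleCat.of R R) n))
      ?_ ?_ ?_
    · intro N _ _ _ _
      refine subsingleton_of_forall_eq 0 fun x => ?_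
      have h0 : 𝟙 (ModuleCat.of R N) = 0 := by
        ext a
        exact Subsingleton.elim _ _
      rw [← Ext.mk₀_id_comp x, h0, Ext.mk₀_zero, Ext.zero_comp]
    · intro N _ _ _ p e
      have hp : Subsingleton
          (Abelian.Ext (ModuleCat.of R (R ⧸ p.asIdeal)) (ModuleCat.of R R) n) := by
        by_cases h : p.asIdeal = maximalIdeal R
        · rw [h]
          exact hk
        · exact subsingleton_ext_quotient_prime hV p.asIdeal h
      refine subsingleton_of_forall_eq 0 fun x => ?_
      have h1 : e.toModuleIso.hom ≫ e.toModuleIso.inv = 𝟙 (ModuleCat.of R N) :=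
        Iso.hom_inv_id _
      rw [← Ext.mk₀_id_comp x, ← h1, ← Ext.mk₀_comp_mk₀,
        Ext.comp_assoc _ _ _ (zero_add 0) (zero_add _) (by simp),
        hp.elim ((Ext.mk₀ e.toModuleIso.inv).comp x (zero_add n)) 0, Ext.comp_zero]
    · intro N₁ _ _ _ N₂ _ _ _ N₃ _ _ _ f g hf hg hfg h₁ h₃
      let S : ShortComplex (ModuleCat.{u} R) :=
        ShortComplex.mk (ModuleCat.ofHom f) (ModuleCat.ofHom g) (by
          ext a
          exact hfg.apply_apply_eq_zero a)
      have hS : S.ShortExact := ModuleCat.shortComplex_shortExact S hfg hf hg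
      refine subsingleton_of_forall_eq 0 fun x => ?_
      obtain ⟨y, rfl⟩ := Ext.contravariant_sequence_exact₂ hS (ModuleCat.of R R) x (h₁.elim _ _)
      exact (congrArg (fun z => Ext.comp _ z _) (h₃.elim y 0)).trans (Ext.comp_zero ..)
  intro N hN i hi
  rcases hi.eq_or_lt with rfl | hi
  · exact main N
  · exact hV N hN i hi

/-- If `rs` is a regular sequence with `maximalIdeal R` associated to `R ⧸ rs`, then finite
injective dimension of `R` is bounded by the length of `rs`. -/
theorem ExtVanishing.of_socle {n : ℕ} (hV : ExtVanishing R n) (rs : List R)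
    (reg : IsRegular R rs)
    (hm : IsAssociatedPrime (maximalIdeal R) (R ⧸ Ideal.ofList rs)) :
    ExtVanishing R (rs.length + 1) := by
  have hpd : ∀ i, rs.length < i → Subsingleton
      (Abelian.Ext (ModuleCat.of R (R ⧸ Ideal.ofList rs)) (ModuleCat.of R R) i) := by
    intro i hi
    have h1 := ModuleCat.projectiveDimension_quotient_eq_length.{u} rs reg
    have e : ModuleCat.of R (Shrink.{u} (R ⧸ Ideal.ofList rs)) ≅
        ModuleCat.of R (R ⧸ Ideal.ofList rs) := (Shrink.linearEquiv R _).toModuleIso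
    rw [projectiveDimension_eq_of_iso e] at h1
    have h2 : HasProjectiveDimensionLT (ModuleCat.of R (R ⧸ Ideal.ofList rs)) i := by
      rw [← projectiveDimension_lt_iff, h1]
      exact_mod_cast hi
    exact HasProjectiveDimensionLT.subsingleton _ i i le_rfl _
  obtain ⟨f, hf⟩ : ∃ f : R ⧸ maximalIdeal R →ₗ[R] R ⧸ Ideal.ofList rs, Function.Injective f := by
    rw [isAssociatedPrime_iff_exists_injective_linearMap] at hm
    exact hm.2
  -- The residue field embeds in R/(rs) by `f`, so its Ext^k lies between Ext^k(R/(rs), R), zero by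
  -- projective dimension, and Ext^{k+1} of the cokernel, zero by assumption.
  have step : ∀ k, rs.length < k → ExtVanishing R (k + 1) → ExtVanishing R k := by
    intro k hk hVk
    refine hVk.of_residueField ?_
    let S : ShortComplex (ModuleCat.{u} R) :=
      ShortComplex.mk (ModuleCat.ofHom f) (ModuleCat.ofHom (LinearMap.range f).mkQ) (by
        ext
        simp)
    have hS : S.ShortExact := ModuleCat.shortComplex_shortExact S
      (f.exact_map_mkQ_range) hf (Submodule.mkQ_surjective _)
    refine subsingleton_of_forall_eq 0 fun x => ?_
    have hc : Subsingleton (Abelian.Ext S.X₃ (ModuleCat.of R R) (k + 1)) :=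
      hVk S.X₃ (by dsimp [S]; infer_instance) _ le_rfl
    obtain ⟨y, rfl⟩ := Ext.contravariant_sequence_exact₁ hS (ModuleCat.of R R) x (add_comm 1 k)
      (hc.elim _ _)
    exact (congrArg (fun z => Ext.comp _ z _) ((hpd k hk).elim y 0)).trans (Ext.comp_zero ..)
  have descend : ∀ j, ExtVanishing R (rs.length + 1 + j) → ExtVanishing R (rs.length + 1) := by
    intro j
    induction j with
    | zero => exact id
    | succ j ih => exact fun h => ih (step _ (by omega) h)
  exact descend n fun N hN i hi => hV N hN i (by omega)

/-- A non-maximal prime is not associated to `R ⧸ rs` when top-degree extensions are bounded by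
the length of `rs`, so that `rs` generates an ideal primary to the maximal ideal. -/
theorem radical_ofList_eq_maximalIdeal {rs : List R} (reg : IsRegular R rs)
    (hV : ExtVanishing R (rs.length + 1)) :
    (Ideal.ofList rs).radical = maximalIdeal R := by
  have hne : Ideal.ofList rs ≠ ⊤ := by
    intro h
    exact reg.2 (by rw [h]; simp)
  have hmin : ∀ P ∈ (Ideal.ofList rs).minimalPrimes, P = maximalIdeal R := by
    intro P hP
    by_contra hPm
    have : P.IsPrime := hP.1.1
    have hass : IsAssociatedPrime P (R ⧸ Ideal.ofList rs) := by
      have h := Module.associatedPrimes.minimalPrimes_annihilator_subset_associatedPrimes R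
        (R ⧸ Ideal.ofList rs)
      rw [Ideal.annihilator_quotient] at h
      exact h hP
    rw [isAssociatedPrime_iff_exists_injective_linearMap] at hass
    obtain ⟨-, f, hf⟩ := hass
    obtain ⟨-, η, hη⟩ := exists_universal_ext (ModuleCat.of R R) rs reg.1
    have hsub := subsingleton_ext_quotient_prime hV P hPm
    have hb := hη (ModuleCat.of R (R ⧸ P)) (by
      intro r hr a
      obtain ⟨a, rfl⟩ := Ideal.Quotient.mk_surjective a
      change Ideal.Quotient.mk P (r * a) = 0
      rw [Ideal.Quotient.eq_zero_iff_mem]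
      exact P.mul_mem_right _ (hP.1.2 (Ideal.subset_span hr)))
    let e : (R ⧸ Ideal.ofList rs) ≃ₗ[R] (R ⧸ Ideal.ofList rs • (⊤ : Submodule R R)) :=
      Submodule.quotEquivOfEq _ _ (by simp)
    -- Rees's isomorphism identifies Hom(R/P, R/(rs)) with Ext(R/P, R) in degree `rs.length`, which
    -- vanishes for non-maximal P.
    have hz : ModuleCat.ofHom (e.toLinearMap ∘ₗ f) = 0 := hb.1 (hsub.elim _ _)
    have h1 := congrArg (fun g => g.hom (1 : R ⧸ P)) hz
    have h2 : f 1 = 0 := by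
      apply e.injective
      rw [map_zero]
      exact h1
    have h3 : (1 : R ⧸ P) = 0 := hf (by rw [h2, map_zero])
    exact one_ne_zero h3
  apply le_antisymm
  · have h1 : Ideal.ofList rs ≤ maximalIdeal R := le_maximalIdeal hne
    exact (Ideal.radical_mono h1).trans (Ideal.IsPrime.radical inferInstance).le
  · rw [← Ideal.sInf_minimalPrimes]
    exact le_sInf fun P hP => (hmin P hP).ge

end LocalVanishing

end FSing

namespace FSing

open Abelian RingTheory.Sequence IsLocalRing

/-! ### Maximal regular sequences and systems of parameters -/

section Depth

variable {R : Type u} [CommRing R] [IsLocalRing R] [IsNoetherianRing R]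

omit [IsNoetherianRing R] in
theorem ringKrullDim_quotient_eq_zero {I : Ideal R} (hI : I.radical = maximalIdeal R) :
    ringKrullDim (R ⧸ I) = 0 := by
  have hne : I ≠ ⊤ := by
    rintro rfl
    rw [Ideal.radical_top] at hI
    exact (Ideal.IsPrime.ne_top (maximalIdeal.isMaximal R).isPrime) hI.symm
  have : Nontrivial (R ⧸ I) := Ideal.Quotient.nontrivial_iff.mpr hne
  rw [← ringKrullDimZero_iff_ringKrullDim_eq_zero,
    Ideal.krullDimLE_zero_quotient_iff_forall_minimalPrimes_isMaximal]
  intro J hJ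
  have hJp : J.IsPrime := hJ.1.1
  have h : maximalIdeal R ≤ J := hI ▸ hJp.radical_le_iff.mpr hJ.1.2
  rw [← (maximalIdeal.isMaximal R).eq_of_le hJp.ne_top h]
  exact maximalIdeal.isMaximal R

/-- A weakly regular sequence in an ideal `J` extends to a regular sequence `rs` in `J` such that
`J` lies in an associated prime of `R ⧸ rs`. -/
theorem exists_maximal_isRegular {J : Ideal R} (hJ : J ≤ maximalIdeal R) (rs : List R)
    (hrs : ∀ r ∈ rs, r ∈ J) (reg : IsWeaklyRegular R rs) :
    ∃ rs' : List R, (∀ r ∈ rs ++ rs', r ∈ J) ∧ IsRegular R (rs ++ rs') ∧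
      ∃ Q, IsAssociatedPrime Q (R ⧸ Ideal.ofList (rs ++ rs')) ∧ J ≤ Q := by
  obtain ⟨d, hd⟩ : ∃ d : ℕ, ringKrullDim R = d := by
    have h1 := ringKrullDim_ne_top (R := R)
    have h2 := ringKrullDim_ne_bot (R := R)
    obtain ⟨e, he⟩ := WithBot.ne_bot_iff_exists.mp h2
    rw [← he] at h1 ⊢
    have h3 : e ≠ ⊤ := fun h => h1 (by rw [h]; rfl)
    obtain ⟨d, rfl⟩ := ENat.ne_top_iff_exists.mp h3
    exact ⟨d, rfl⟩
  have toReg : ∀ l : List R, (∀ r ∈ l, r ∈ J) → IsWeaklyRegular R l → IsRegular R l :=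
    fun l hl h => IsRegular.of_isWeaklyRegular_of_mem_maximalIdeal R (fun r hr => hJ (hl r hr)) h
  have bound : ∀ l : List R, IsRegular R l → l.length ≤ d := by
    intro l hl
    have h1 := ringKrullDim_add_length_eq_ringKrullDim_of_isRegular l hl
    have hne : Ideal.ofList l ≠ ⊤ := by
      intro h
      exact hl.2 (by rw [h]; simp)
    have : Nontrivial (R ⧸ Ideal.ofList l) := Ideal.Quotient.nontrivial_iff.mpr hne
    have h2 := ringKrullDim_nonneg_of_nontrivial (R := R ⧸ Ideal.ofList l)
    rw [hd] at h1
    have h3 : (l.length : WithBot ℕ∞) ≤ d := by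
      rw [← h1]
      exact le_add_of_nonneg_left h2
    exact_mod_cast h3
  obtain ⟨k, hk⟩ : ∃ k, d - rs.length = k := ⟨_, rfl⟩
  induction k using Nat.strong_induction_on generalizing rs with
  | _ k ih =>
    by_cases hQ : ∃ Q, IsAssociatedPrime Q (R ⧸ Ideal.ofList rs) ∧ J ≤ Q
    · refine ⟨[], by simpa using hrs, ?_⟩
      rw [List.append_nil]
      exact ⟨toReg rs hrs reg, hQ⟩
    · have hfin := associatedPrimes.finite R (R ⧸ Ideal.ofList rs)
      obtain ⟨x, hxJ, hx⟩ : ∃ x ∈ J, ∀ Q ∈ associatedPrimes R (R ⧸ Ideal.ofList rs), x ∉ Q := by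
        by_contra! h
        have hsub : (J : Set R) ⊆ ⋃ Q ∈ (hfin.toFinset : Set (Ideal R)), (Q : Set R) := by
          intro x hx
          obtain ⟨Q, hQ, hxQ⟩ := h x hx
          simp only [Set.mem_iUnion]
          exact ⟨Q, by simpa using hQ, hxQ⟩
        rw [Ideal.subset_union_prime (f := fun Q => Q) ⊥ ⊥
          (fun Q hQ _ _ => IsAssociatedPrime.isPrime (hfin.mem_toFinset.mp hQ))] at hsub
        obtain ⟨Q, hQ', hJQ⟩ := hsub
        exact hQ ⟨Q, hfin.mem_toFinset.mp hQ', hJQ⟩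
      have hxreg : IsSMulRegular (R ⧸ Ideal.ofList rs) x := by
        have h1 := biUnion_associatedPrimes_eq_compl_regular R (R ⧸ Ideal.ofList rs)
        by_contra hn
        have : x ∈ ({r | IsSMulRegular (R ⧸ Ideal.ofList rs) r}ᶜ : Set R) := hn
        rw [← h1] at this
        simp only [Set.mem_iUnion] at this
        obtain ⟨Q, hQ', hxQ⟩ := this
        exact hx Q hQ' hxQ
      have hw : IsWeaklyRegular R (rs ++ [x]) := by
        rw [isWeaklyRegular_append_iff]
        refine ⟨reg, ?_⟩
        rw [isWeaklyRegular_singleton_iff]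
        have e : (R ⧸ Ideal.ofList rs) ≃ₗ[R] (R ⧸ Ideal.ofList rs • (⊤ : Submodule R R)) :=
          Submodule.quotEquivOfEq _ _ (by simp)
        exact (e.isSMulRegular_congr x).mp hxreg
      have hmem : ∀ r ∈ rs ++ [x], r ∈ J := by
        intro r hr
        rcases List.mem_append.mp hr with hr | hr
        · exact hrs r hr
        · rw [List.mem_singleton.mp hr]
          exact hxJ
      have hb := bound _ (toReg _ hmem hw)
      have hlen : (rs ++ [x]).length = rs.length + 1 := by simp
      obtain ⟨rs', h1, h2, h3⟩ := ih (d - (rs ++ [x]).length) (by omega) (rs ++ [x]) hmem hw rfl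
      rw [List.append_assoc] at h1 h2 h3
      exact ⟨[x] ++ rs', h1, h2, h3⟩

open scoped Pointwise in
/-- Depth is bounded by the dimension of every associated prime. -/
theorem length_le_ringKrullDim_of_isAssociatedPrime (rs : List R)
    (hrs : ∀ r ∈ rs, r ∈ maximalIdeal R)
    (M : Type u) [AddCommGroup M] [Module R M] [Module.Finite R M] (reg : IsWeaklyRegular M rs)
    {P : Ideal R} (hP : IsAssociatedPrime P M) :
    (rs.length : WithBot ℕ∞) ≤ ringKrullDim (R ⧸ P) := by
  induction rs generalizing M P with
  | nil =>
    have := hP.isPrime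
    simpa using ringKrullDim_nonneg_of_nontrivial (R := R ⧸ P)
  | cons y rs ih =>
    have hPp := hP.isPrime
    rw [isWeaklyRegular_cons_iff] at reg
    obtain ⟨-, f, hf⟩ := (isAssociatedPrime_iff_exists_injective_linearMap P M).mp hP
    have hyP : y ∉ P := by
      intro hy
      have h1 : y • f 1 = 0 := by
        rw [← map_smul]
        have : y • (1 : R ⧸ P) = 0 := by
          change Ideal.Quotient.mk P (y * 1) = 0
          rw [Ideal.Quotient.eq_zero_iff_mem]
          simpa using hy
        rw [this, map_zero]
      have h2 : f 1 = 0 := reg.1 (by simpa using h1)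
      exact one_ne_zero (hf (h2.trans (map_zero f).symm))
    -- If every element of M killed by P were divisible by y, regularity of y would give N = yN, so
    -- N = 0 by Nakayama. Hence some n ∈ N is nonzero in M/yM, and an associated prime of M/yM
    -- containing its annihilator contains both P and y.
    let N := Submodule.torsionBySet R M (P : Set R)
    have hmem : ∀ m : M, m ∈ N ↔ ∀ a ∈ P, a • m = 0 := fun m => by
      simp [N, Submodule.mem_torsionBySet_iff]
    obtain ⟨n, hnN, hny⟩ : ∃ n ∈ N, ∀ m : M, y • m ≠ n := by
      by_contra! h
      have hle : N ≤ Ring.jacobson R • N := by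
        intro n hn
        obtain ⟨m, rfl⟩ := h n hn
        refine Submodule.smul_mem_smul ?_ ?_
        · rw [ringJacobson_eq_maximalIdeal]
          exact hrs y (by simp)
        · rw [hmem] at hn ⊢
          intro a ha
          apply reg.1
          change y • a • m = y • (0 : M)
          rw [smul_comm, hn a ha, smul_zero]
      have hbot : N = ⊥ := (IsNoetherian.noetherian N).eq_bot_of_le_jacobson_smul hle
      have h1 : f 1 ∈ N := by
        rw [hmem]
        intro a ha
        rw [← map_smul]
        have : a • (1 : R ⧸ P) = 0 := by
          change Ideal.Quotient.mk P (a * 1) = 0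
          rw [Ideal.Quotient.eq_zero_iff_mem]
          simpa using ha
        rw [this, map_zero]
      rw [hbot, Submodule.mem_bot] at h1
      exact one_ne_zero (hf (h1.trans (map_zero f).symm))
    let q : M →ₗ[R] QuotSMulTop y M := Submodule.mkQ _
    have hq : q n ≠ 0 := by
      intro h
      have h1 : n ∈ y • (⊤ : Submodule R M) := (Submodule.Quotient.mk_eq_zero _).mp h
      rw [Submodule.mem_smul_pointwise_iff_exists] at h1
      obtain ⟨m, -, hm⟩ := h1
      exact hny m hm
    obtain ⟨Q, hQ, hle⟩ := exists_le_isAssociatedPrime_of_isNoetherianRing R (q n) hq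
    have hPQ : P ≤ Q := by
      intro a ha
      apply hle
      rw [Submodule.mem_colon_singleton, Submodule.mem_bot, ← map_smul, (hmem n).mp hnN a ha,
        map_zero]
    have hyQ : y ∈ Q := by
      apply hle
      rw [Submodule.mem_colon_singleton, Submodule.mem_bot, ← map_smul]
      exact (Submodule.Quotient.mk_eq_zero _).mpr (Submodule.smul_mem_pointwise_smul _ _ _ trivial)
    have h1 := ih (fun r hr => hrs r (by simp [hr])) (QuotSMulTop y M) reg.2 hQ
    have h2 : ringKrullDim (R ⧸ Q) + 1 ≤ ringKrullDim (R ⧸ P) := by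
      refine ringKrullDim_succ_le_of_surjective (Ideal.Quotient.factor hPQ)
        (Ideal.Quotient.factor_surjective hPQ) (r := Ideal.Quotient.mk P y) ?_ ?_
      · rw [mem_nonZeroDivisors_iff_ne_zero, Ne, Ideal.Quotient.eq_zero_iff_mem]
        exact hyP
      · rw [Ideal.Quotient.factor_mk, Ideal.Quotient.eq_zero_iff_mem]
        exact hyQ
    calc ((y :: rs).length : WithBot ℕ∞) = (rs.length : WithBot ℕ∞) + 1 := by simp
      _ ≤ ringKrullDim (R ⧸ Q) + 1 := by gcongr
      _ ≤ _ := h2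

/-- If `m` is the only prime containing `P` and `xs`, then `R ⧸ P` has dimension at most the
length of `xs`. -/
theorem ringKrullDim_quotient_le_length (P : Ideal R) [P.IsPrime] (xs : List R)
    (hxs : ∀ r ∈ xs, r ∈ maximalIdeal R)
    (h : ∀ Q : Ideal R, Q.IsPrime → P ≤ Q → (∀ r ∈ xs, r ∈ Q) → Q = maximalIdeal R) :
    ringKrullDim (R ⧸ P) ≤ xs.length := by
  have hloc : IsLocalRing (R ⧸ P) :=
    IsLocalRing.of_surjective' (Ideal.Quotient.mk P) Ideal.Quotient.mk_surjective
  have hmk : ∀ x : R, Ideal.Quotient.mk P x ∈ maximalIdeal (R ⧸ P) ↔ x ∈ maximalIdeal R := by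
    intro x
    constructor
    · intro hx hu
      exact hx (hu.map _)
    · intro hx hu
      obtain ⟨y, hy⟩ := hu.exists_right_inv
      obtain ⟨y, rfl⟩ := Ideal.Quotient.mk_surjective y
      rw [← map_mul, ← map_one (Ideal.Quotient.mk P), Ideal.Quotient.mk_eq_mk_iff_sub_mem] at hy
      have h1 : x * y - 1 ∈ maximalIdeal R := le_maximalIdeal (Ideal.IsPrime.ne_top ‹_›) hy
      have h2 : (1 : R) ∈ maximalIdeal R := by
        have := Ideal.sub_mem _ (Ideal.mul_mem_right y _ hx) h1
        rwa [sub_sub_cancel] at this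
      exact h2 isUnit_one
  classical
  let s : Finset (R ⧸ P) := (xs.map (Ideal.Quotient.mk P)).toFinset
  have hs : ∀ z, z ∈ s ↔ ∃ x ∈ xs, Ideal.Quotient.mk P x = z := by simp [s]
  have h1 := ringKrullDim_le_ringKrullDim_quotient_add_card s (by
    intro z hz
    obtain ⟨x, hx, rfl⟩ := (hs z).mp hz
    rw [ringJacobson_eq_maximalIdeal]
    exact (hmk x).mpr (hxs x hx))
  have h2 : Ring.KrullDimLE 0 ((R ⧸ P) ⧸ Ideal.span (s : Set (R ⧸ P))) := by
    rw [Ideal.krullDimLE_zero_quotient_iff_forall_minimalPrimes_isMaximal]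
    intro J hJ
    have hJp : J.IsPrime := hJ.1.1
    have hJm : J.comap (Ideal.Quotient.mk P) = maximalIdeal R := by
      refine h _ (Ideal.IsPrime.comap _) ?_ ?_
      · intro a ha
        rw [Ideal.mem_comap, Ideal.Quotient.eq_zero_iff_mem.mpr ha]
        exact J.zero_mem
      · intro r hr
        exact hJ.1.2 (Ideal.subset_span ((hs _).mpr ⟨r, hr, rfl⟩))
    have : J = maximalIdeal (R ⧸ P) := by
      refine le_antisymm (le_maximalIdeal hJp.ne_top) fun z hz => ?_
      obtain ⟨x, rfl⟩ := Ideal.Quotient.mk_surjective z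
      rw [hmk, ← hJm] at hz
      exact hz
    rw [this]
    exact maximalIdeal.isMaximal _
  rw [Ring.krullDimLE_iff] at h2
  have h3 : s.card ≤ xs.length := (List.toFinset_card_le _).trans (by simp)
  calc ringKrullDim (R ⧸ P) ≤ _ := h1
    _ ≤ ((0 : ℕ) : WithBot ℕ∞) + (xs.length : WithBot ℕ∞) := by
      gcongr
    _ = xs.length := by simp

/-- Over a local ring, a sequence that is as long as a regular sequence on `M` and cuts the
support of `M` down to the closed point is weakly `M`-regular. -/
theorem isWeaklyRegular_of_isRegular (xs : List R) (hxs : ∀ r ∈ xs, r ∈ maximalIdeal R)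
    (M : Type u) [AddCommGroup M] [Module R M] [Module.Finite R M]
    (hsupp : ∀ P : PrimeSpectrum R, P ∈ Module.support R M → (∀ r ∈ xs, r ∈ P.asIdeal) →
      P.asIdeal = maximalIdeal R)
    (ys : List R) (hys : ∀ r ∈ ys, r ∈ maximalIdeal R) (reg : IsRegular M ys)
    (hlen : xs.length = ys.length) : IsWeaklyRegular M xs := by
  induction xs generalizing M ys with
  | nil => simp
  | cons x xs ih =>
    have hMnt : Nontrivial M := reg.nontrivial
    have hxreg : IsSMulRegular M x := by
      by_contra hn
      have hx : x ∈ ({r | IsSMulRegular M r}ᶜ : Set R) := hn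
      rw [← biUnion_associatedPrimes_eq_compl_regular] at hx
      simp only [Set.mem_iUnion] at hx
      obtain ⟨P, hP, hxP⟩ := hx
      have hPp : P.IsPrime := IsAssociatedPrime.isPrime hP
      have h1 := length_le_ringKrullDim_of_isAssociatedPrime ys hys M reg.1 hP
      -- If x lay in the associated prime P, the remaining elements would cut R/P down to the closed
      -- point, making its dimension smaller than the depth witnessed by `ys`.
      have h2 := ringKrullDim_quotient_le_length P xs (fun r hr => hxs r (by simp [hr])) (by
        intro Q hQ hPQ hxQ
        refine hsupp ⟨Q, hQ⟩ ?_ ?_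
        · rw [Module.mem_support_iff_of_finite]
          have := IsAssociatedPrime.annihilator_le hP
          rw [Submodule.annihilator_top] at this
          exact this.trans hPQ
        · intro r hr
          rcases List.mem_cons.mp hr with rfl | hr
          · exact hPQ hxP
          · exact hxQ r hr)
      have h3 := h1.trans h2
      rw [← hlen] at h3
      have h4 : (x :: xs).length ≤ xs.length := by exact_mod_cast h3
      simp at h4
    have hxm : x ∈ maximalIdeal R := hxs x (by simp)
    have hnt : Nontrivial (QuotSMulTop x M) := nontrivial_quotSMulTop_of_mem_maximalIdeal M hxm
    have hlt : ∀ (L : Type u) [AddCommGroup L] [Module R L] [Module.Finite R L] [Nontrivial L],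
        maximalIdeal R • (⊤ : Submodule R L) < ⊤ := by
      intro L _ _ _ _
      refine lt_top_iff_ne_top.mpr fun h => ?_
      refine top_ne_bot (α := Submodule R L) ?_
      refine Module.Finite.fg_top.eq_bot_of_le_jacobson_smul ?_
      rw [ringJacobson_eq_maximalIdeal, h]
    have hext := fun i hi => ModuleCat.subsingleton_ext_of_exists_isRegular (maximalIdeal R)
      (ModuleCat.of R (R ⧸ maximalIdeal R)) (by
        rw [Module.support_eq_zeroLocus, Ideal.annihilator_quotient]) (ModuleCat.of R M) (hlt M)
      ys hys reg i hi
    -- M/xM loses only one from the depth: by dimension shifting along `δ`, its Ext from the residue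
    -- field vanishes below degree `xs.length`.
    obtain ⟨zs, hz1, hz2, hz3⟩ := ModuleCat.exists_isRegular_of_exists_subsingleton_ext
      (maximalIdeal R) xs.length (ModuleCat.of R (QuotSMulTop x M)) (hlt (QuotSMulTop x M))
      (ModuleCat.of R (R ⧸ maximalIdeal R))
      (by rw [Module.support_eq_zeroLocus, Ideal.annihilator_quotient]) (by
        intro i hi
        obtain ⟨δ, hδ, -⟩ := exists_ext_quotSMulTop (ModuleCat.of R M) hxreg
        simp only [List.length_cons] at hlen
        refine subsingleton_of_forall_eq 0 fun y => ?_
        have e1 := hext i (by omega)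
        have e2 := hext (i + 1) (by omega)
        obtain ⟨g, z, rfl⟩ := hδ _ i y (e2.elim _ _)
        rw [e1.elim z 0, Ext.zero_comp])
    rw [isWeaklyRegular_cons_iff]
    refine ⟨hxreg, ih (fun r hr => hxs r (by simp [hr])) (QuotSMulTop x M) ?_ zs hz2 hz3 hz1.symm⟩
    intro P hP hPxs
    rw [Module.support_quotSMulTop] at hP
    refine hsupp P hP.1 fun r hr => ?_
    rcases List.mem_cons.mp hr with rfl | hr
    · simpa using hP.2
    · exact hPxs r hr

end Depth

/-! ### Consequences of finite injective dimension -/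

section Gorenstein

variable {R : Type u} [CommRing R] [IsLocalRing R]

theorem IsGorensteinLocal.exists_extVanishing (hR : IsGorensteinLocal R) :
    ∃ n, ExtVanishing R n := by
  obtain ⟨n, hn⟩ := hR
  exact ⟨n + 1, fun N _ i hi => HasInjectiveDimensionLT.subsingleton _ (n + 1) i hi N⟩

variable [IsNoetherianRing R]

/-- A maximal regular sequence of a Gorenstein local ring is a system of parameters and bounds
the injective dimension. -/
theorem IsGorensteinLocal.extVanishing_and_radical (hR : IsGorensteinLocal R) {rs : List R}
    (reg : IsRegular R rs) (hm : IsAssociatedPrime (maximalIdeal R) (R ⧸ Ideal.ofList rs)) :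
    ExtVanishing R (rs.length + 1) ∧ (Ideal.ofList rs).radical = maximalIdeal R := by
  obtain ⟨n, hn⟩ := hR.exists_extVanishing
  have := hn.of_socle rs reg hm
  exact ⟨this, radical_ofList_eq_maximalIdeal reg this⟩

/-- A weakly regular sequence of a Gorenstein local ring extends to a regular system of parameters
whose length bounds the injective dimension. -/
theorem IsGorensteinLocal.exists_append (hR : IsGorensteinLocal R) (rs : List R)
    (hrs : ∀ r ∈ rs, r ∈ maximalIdeal R) (reg : IsWeaklyRegular R rs) :
    ∃ rs' : List R, (∀ r ∈ rs ++ rs', r ∈ maximalIdeal R) ∧ IsRegular R (rs ++ rs') ∧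
      ExtVanishing R ((rs ++ rs').length + 1) ∧
      (Ideal.ofList (rs ++ rs')).radical = maximalIdeal R ∧
      ringKrullDim R = (rs ++ rs').length := by
  obtain ⟨rs', h1, h2, Q, hQ, hle⟩ := exists_maximal_isRegular le_rfl rs hrs reg
  have hQm : maximalIdeal R = Q :=
    (maximalIdeal.isMaximal R).eq_of_le hQ.isPrime.ne_top hle
  rw [← hQm] at hQ
  obtain ⟨h3, h4⟩ := hR.extVanishing_and_radical h2 hQ
  refine ⟨rs', h1, h2, h3, h4, ?_⟩
  rw [← ringKrullDim_add_length_eq_ringKrullDim_of_isRegular _ h2,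
    ringKrullDim_quotient_eq_zero h4, zero_add]

/-- In a Gorenstein local ring, `dim R` elements generating an ideal primary to the maximal ideal
form a regular sequence, and `dim R` bounds the injective dimension. -/
theorem IsGorensteinLocal.isRegular_of_radical (hR : IsGorensteinLocal R) {xs : List R}
    (hdim : ringKrullDim R = xs.length) (hrad : (Ideal.ofList xs).radical = maximalIdeal R) :
    IsRegular R xs ∧ ExtVanishing R (xs.length + 1) := by
  obtain ⟨ys, h1, h2, h3, h4, h5⟩ := hR.exists_append [] (by simp) (by simp)
  rw [List.nil_append] at h1 h2 h3 h4 h5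
  have hlen : xs.length = ys.length := by
    rw [h5] at hdim
    exact_mod_cast hdim.symm
  have hxs : ∀ r ∈ xs, r ∈ maximalIdeal R := fun r hr =>
    hrad ▸ Ideal.le_radical (Ideal.subset_span hr)
  refine ⟨IsRegular.of_isWeaklyRegular_of_mem_maximalIdeal R hxs
    (isWeaklyRegular_of_isRegular xs hxs R ?_ ys h1 h2 hlen), hlen ▸ h3⟩
  intro P _ hP
  have hle : maximalIdeal R ≤ P.asIdeal := by
    rw [← hrad, P.isPrime.radical_le_iff]
    exact Ideal.span_le.mpr hP
  exact ((maximalIdeal.isMaximal R).eq_of_le P.isPrime.ne_top hle).symm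

/-- If `rs` is a regular system of parameters of a Gorenstein local ring, then every nonzero element
of a finite module killed by `rs` has nonzero image under some linear map to `R ⧸ rs`. -/
theorem exists_linearMap_apply_ne_zero {rs : List R} (reg : IsRegular R rs)
    (hV : ExtVanishing R (rs.length + 1)) (hrad : (Ideal.ofList rs).radical = maximalIdeal R)
    (N : Type u) [AddCommGroup N] [Module R N] [Module.Finite R N]
    (hN : ∀ r ∈ rs, ∀ n : N, r • n = 0) {n : N} (hn : n ≠ 0) :
    ∃ ψ : N →ₗ[R] R ⧸ Ideal.ofList rs, ψ n ≠ 0 := by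
  have hne : Ideal.ofList rs ≠ ⊤ := by
    intro h
    exact reg.2 (by rw [h]; simp)
  have hnt : Nontrivial (R ⧸ Ideal.ofList rs) := Ideal.Quotient.nontrivial_iff.mpr hne
  obtain ⟨Q, hQ⟩ := associatedPrimes.nonempty R (R ⧸ Ideal.ofList rs)
  have hQp : Q.IsPrime := IsAssociatedPrime.isPrime hQ
  have hQm : Q = maximalIdeal R := by
    have h1 := IsAssociatedPrime.annihilator_le hQ
    rw [Submodule.annihilator_top, Ideal.annihilator_quotient] at h1
    have h2 : maximalIdeal R ≤ Q := hrad ▸ hQp.radical_le_iff.mpr h1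
    exact ((maximalIdeal.isMaximal R).eq_of_le hQp.ne_top h2).symm
  subst hQm
  obtain ⟨-, f, hf⟩ := (isAssociatedPrime_iff_exists_injective_linearMap _ _).mp hQ
  have htor : Ideal.torsionOf R N n ≤ maximalIdeal R := by
    refine le_maximalIdeal fun h => hn ?_
    have : (1 : R) ∈ Ideal.torsionOf R N n := h ▸ Submodule.mem_top
    simpa [Ideal.mem_torsionOf_iff] using this
  let e := Ideal.quotTorsionOfEquivSpanSingleton R N n
  -- The composite Rn → R/𝔪 ↪ R/(rs) does not kill n; it remains to extend it to N.
  let φ : (Submodule.span R {n} : Submodule R N) →ₗ[R] R ⧸ Ideal.ofList rs :=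
    f ∘ₗ Submodule.factor htor ∘ₗ e.symm.toLinearMap
  have hnm : n ∈ Submodule.span R {n} := Submodule.mem_span_singleton_self n
  have hφ : φ ⟨n, hnm⟩ ≠ 0 := by
    have h1 : e.symm ⟨n, hnm⟩ = Submodule.Quotient.mk 1 := by
      rw [LinearEquiv.symm_apply_eq]
      ext
      rw [Ideal.quotTorsionOfEquivSpanSingleton_apply_mk]
      exact (one_smul R n).symm
    have h2 : φ ⟨n, hnm⟩ = f (Submodule.Quotient.mk 1) := by
      simp only [φ, LinearMap.comp_apply, LinearEquiv.coe_coe, h1]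
      rfl
    rw [h2]
    intro h3
    have h4 : (Submodule.Quotient.mk 1 : R ⧸ maximalIdeal R) = 0 := hf (h3.trans (map_zero f).symm)
    exact one_ne_zero h4
  obtain ⟨-, η, hη⟩ := exists_universal_ext (ModuleCat.of R R) rs reg.1
  let q : (R ⧸ Ideal.ofList rs) ≃ₗ[R] (R ⧸ Ideal.ofList rs • (⊤ : Submodule R R)) :=
    Submodule.quotEquivOfEq _ _ (by simp)
  let N' := Submodule.span R {n}
  let S : ShortComplex (ModuleCat.{u} R) :=
    ShortComplex.mk (ModuleCat.ofHom N'.subtype) (ModuleCat.ofHom N'.mkQ) (by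
      ext
      simp)
  have hS : S.ShortExact := ModuleCat.shortComplex_shortExact S
    (LinearMap.exact_subtype_mkQ N') N'.subtype_injective (Submodule.mkQ_surjective _)
  have hbN := hη (ModuleCat.of R N) hN
  have hbN' := hη (ModuleCat.of R N') (fun r hr a => Subtype.ext (hN r hr a.1))
  let φ' : ModuleCat.of R N' ⟶ ModuleCat.of R (R ⧸ Ideal.ofList rs • (⊤ : Submodule R R)) :=
    ModuleCat.ofHom (q.toLinearMap ∘ₗ φ)
  -- Under Rees's isomorphism the obstruction to extending `φ` lies in Ext^{d+1}(N/Rn, R) with d =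
  -- `rs.length`, which is zero.
  have hz : Subsingleton (Abelian.Ext S.X₃ (ModuleCat.of R R) (rs.length + 1)) :=
    hV S.X₃ (by dsimp [S]; infer_instance) _ le_rfl
  obtain ⟨y, hy⟩ := Ext.contravariant_sequence_exact₁ hS (ModuleCat.of R R)
    ((Ext.mk₀ φ').comp η (zero_add _)) (add_comm 1 _) (hz.elim _ _)
  obtain ⟨ψ, hψ⟩ := hbN.2 y
  have hcomp : ModuleCat.ofHom N'.subtype ≫ ψ = φ' := by
    apply hbN'.1
    change (Ext.mk₀ _).comp η _ = (Ext.mk₀ _).comp η _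
    rw [← hy, ← hψ, ← Ext.mk₀_comp_mk₀, Ext.comp_assoc _ _ _ (zero_add 0) (zero_add _) (by simp)]
  refine ⟨q.symm.toLinearMap ∘ₗ ψ.hom, ?_⟩
  have h5 : ψ.hom n = q (φ ⟨n, hnm⟩) :=
    congrArg (fun g : ModuleCat.of R N' ⟶ _ => g.hom ⟨n, hnm⟩) hcomp
  have h6 : (q.symm.toLinearMap ∘ₗ ψ.hom) n = φ ⟨n, hnm⟩ := by
    rw [LinearMap.comp_apply, h5]
    simp
  rw [h6]
  exact hφ

end Gorenstein

end FSing

namespace FSing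

open RingTheory.Sequence IsLocalRing

/-! ### Maps to quotients by powers of a system of parameters -/

section Parameters

variable {R : Type u} [CommRing R] [IsLocalRing R]

omit [IsLocalRing R] in
theorem ofList_ofFn {d : ℕ} (x : Fin d → R) :
    Ideal.ofList (List.ofFn x) = Ideal.span (Set.range x) := by
  unfold Ideal.ofList
  congr 1
  ext r
  simp

theorem IsSystemOfParameters.pow {d : ℕ} {x : Fin d → R} (hx : IsSystemOfParameters R x) {t : ℕ}
    (ht : t ≠ 0) : IsSystemOfParameters R fun i => x i ^ t := by
  refine ⟨hx.1, ?_⟩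
  rw [← hx.2]
  apply le_antisymm
  · refine Ideal.radical_mono (Ideal.span_le.mpr ?_)
    rintro _ ⟨i, rfl⟩
    exact Ideal.pow_mem_of_mem _ (Ideal.subset_span (Set.mem_range_self i)) t (Nat.pos_of_ne_zero ht)
  · rw [Ideal.radical_le_radical_iff, Ideal.span_le]
    rintro _ ⟨i, rfl⟩
    exact Ideal.mem_radical_of_pow_mem (m := t)
      (Ideal.le_radical (Ideal.subset_span (Set.mem_range_self i)))

variable [IsNoetherianRing R]

theorem IsGorensteinLocal.isRegular_of_isSystemOfParameters (hR : IsGorensteinLocal R) {d : ℕ}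
    {x : Fin d → R} (hx : IsSystemOfParameters R x) :
    IsRegular R (List.ofFn x) ∧ ExtVanishing R (d + 1) := by
  have h := hR.isRegular_of_radical (xs := List.ofFn x) (by simpa using hx.1)
    (by rw [ofList_ofFn]; exact hx.2)
  rwa [List.length_ofFn] at h

theorem IsGorensteinLocal.exists_isSystemOfParameters (hR : IsGorensteinLocal R) :
    ∃ (d : ℕ) (x : Fin d → R), IsSystemOfParameters R x := by
  obtain ⟨ys, -, -, -, h4, h5⟩ := hR.exists_append [] (by simp) (by simp)
  rw [List.nil_append] at h4 h5
  refine ⟨ys.length, fun i => ys[i], h5, ?_⟩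
  rw [← ofList_ofFn]
  simpa using h4

/-- Nonzero elements of finite modules over a Gorenstein local ring are detected by maps to the
quotients `R ⧸ (x₁ᵗ, …, x_dᵗ)`. -/
theorem IsGorensteinLocal.exists_linearMap_quotient_pow (hR : IsGorensteinLocal R) {d : ℕ}
    {x : Fin d → R} (hx : IsSystemOfParameters R x) {T : Set ℕ} (hT : T.Infinite)
    (M : Type u) [AddCommGroup M] [Module R M] [Module.Finite R M] {m : M} (hm : m ≠ 0) :
    ∃ t ∈ T, ∃ g : M →ₗ[R] R ⧸ Ideal.span (Set.range fun i => x i ^ t), g m ≠ 0 := by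
  have hinf := Ideal.iInf_pow_smul_eq_bot_of_isLocalRing (M := M) (maximalIdeal R)
    (Ideal.IsPrime.ne_top inferInstance)
  obtain ⟨n, hn⟩ : ∃ n, m ∉ maximalIdeal R ^ n • (⊤ : Submodule R M) := by
    by_contra! h
    have : m ∈ (⨅ i, maximalIdeal R ^ i • (⊤ : Submodule R M)) := by
      rw [Submodule.mem_iInf]
      exact h
    rw [hinf, Submodule.mem_bot] at this
    exact hm this
  -- The inequality n < t puts (xᵗ) inside 𝔪ⁿ, so m stays nonzero in M/(xᵗ)M, and it also excludes t
  -- = 0.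
  obtain ⟨t, htT, ht⟩ := hT.exists_gt n
  let y : Fin d → R := fun i => x i ^ t
  have hy : IsSystemOfParameters R y := hx.pow (by omega)
  obtain ⟨reg, hV⟩ := hR.isRegular_of_isSystemOfParameters hy
  let J : Ideal R := Ideal.span (Set.range y)
  have hJ : J ≤ maximalIdeal R ^ n := by
    refine Ideal.span_le.mpr ?_
    rintro _ ⟨i, rfl⟩
    have hxi : x i ∈ maximalIdeal R := hx.2 ▸ Ideal.le_radical (Ideal.subset_span ⟨i, rfl⟩)
    exact Ideal.pow_le_pow_right ht.le (Ideal.pow_mem_pow hxi t)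
  let N := M ⧸ J • (⊤ : Submodule R M)
  let q : M →ₗ[R] N := Submodule.mkQ _
  have hq : q m ≠ 0 := by
    intro h
    exact hn (Submodule.smul_mono_left hJ ((Submodule.Quotient.mk_eq_zero _).mp h))
  obtain ⟨ψ, hψ⟩ := exists_linearMap_apply_ne_zero reg (by rwa [List.length_ofFn])
    (by rw [ofList_ofFn]; exact hy.2) N (by
      intro r hr a
      obtain ⟨a, rfl⟩ := Submodule.mkQ_surjective _ a
      rw [← map_smul]
      refine (Submodule.Quotient.mk_eq_zero _).mpr (Submodule.smul_mem_smul ?_ trivial)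
      obtain ⟨i, rfl⟩ := List.mem_ofFn.mp hr
      exact Ideal.subset_span ⟨i, rfl⟩) hq
  let e : (R ⧸ Ideal.ofList (List.ofFn y)) ≃ₗ[R] R ⧸ J := Submodule.quotEquivOfEq _ _ (ofList_ofFn y)
  refine ⟨t, htT, e.toLinearMap ∘ₗ ψ ∘ₗ q, fun h => hψ (e.injective ?_)⟩
  rw [map_zero]
  exact h

/-- A closure on ideals compatible with multiplication is trivial as soon as it fixes infinitely
many powers of a system of parameters. -/
theorem IsGorensteinLocal.closure_subset (hR : IsGorensteinLocal R) (cl : Ideal R → Set R)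
    (hcl : ∀ (I J : Ideal R) (y u : R), (∀ a ∈ I, y * a ∈ J) → u ∈ cl I → y * u ∈ cl J)
    {d : ℕ} {x : Fin d → R} (hx : IsSystemOfParameters R x) {T : Set ℕ} (hT : T.Infinite)
    (hclosed : ∀ t ∈ T, cl (Ideal.span (Set.range fun i => x i ^ t)) ⊆
      (Ideal.span (Set.range fun i => x i ^ t) : Ideal R)) (I : Ideal R) : cl I ⊆ I := by
  intro u hu
  by_contra huI
  obtain ⟨t, ht, g, hg⟩ := hR.exists_linearMap_quotient_pow hx hT (R ⧸ I)
    (m := Ideal.Quotient.mk I u) (by rwa [Ne, Ideal.Quotient.eq_zero_iff_mem])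
  -- A linear map out of R/I is multiplication by a lift y of its value at 1, which is why the
  -- hypothesis `hcl` suffices.
  obtain ⟨y, hy⟩ := Ideal.Quotient.mk_surjective (g 1)
  have key : ∀ a : R, g (Ideal.Quotient.mk I a) = Ideal.Quotient.mk _ (y * a) := by
    intro a
    have h1 : Ideal.Quotient.mk I a = a • (1 : R ⧸ I) := by
      rw [Algebra.smul_def, mul_one]
      rfl
    rw [h1, map_smul, ← hy, mul_comm, Algebra.smul_def, map_mul]
    rfl
  have h2 : y * u ∈ cl (Ideal.span (Set.range fun i => x i ^ t)) := by
    refine hcl I _ y u (fun a ha => ?_) hu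
    rw [← Ideal.Quotient.eq_zero_iff_mem, ← key, Ideal.Quotient.eq_zero_iff_mem.mpr ha, map_zero]
  apply hg
  rw [key, Ideal.Quotient.eq_zero_iff_mem]
  exact hclosed t ht h2

/-- A functorial residual closure operation on a Gorenstein local ring that fixes infinitely many
powers of a system of parameters is trivial. -/
theorem IsGorensteinLocal.closureOperation_trivial (hR : IsGorensteinLocal R)
    (c : ClosureOperation R) (hf : c.Functorial) (hr : c.Residual) {d : ℕ} {x : Fin d → R}
    (hx : IsSystemOfParameters R x)
    (hT : {t : ℕ | c.cl R (Ideal.span (Set.range fun i => x i ^ t)) =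
      Ideal.span (Set.range fun i => x i ^ t)}.Infinite) :
    (∀ I : Ideal R, c.cl R I = I) ∧
      ∀ (M : Type u) [AddCommGroup M] [Module R M] [Module.Finite R M],
        c.cl M (⊥ : Submodule R M) = ⊥ := by
  have hM : ∀ (M : Type u) [AddCommGroup M] [Module R M] [Module.Finite R M],
      c.cl M (⊥ : Submodule R M) = ⊥ := by
    intro M _ _ _
    rw [eq_bot_iff]
    intro m hm
    by_contra hm0
    obtain ⟨t, ht, g, hg⟩ := hR.exists_linearMap_quotient_pow hx hT M hm0
    have ht' : c.cl R (Ideal.span (Set.range fun i => x i ^ t)) =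
      Ideal.span (Set.range fun i => x i ^ t) := ht
    have h1 : g m ∈ c.cl (R ⧸ Ideal.span (Set.range fun i => x i ^ t)) ⊥ := by
      have := hf M _ g ⊥ (Submodule.mem_map_of_mem hm)
      rwa [Submodule.map_bot] at this
    obtain ⟨a, ha⟩ := Submodule.mkQ_surjective _ (g m)
    have h2 := hr R _ (Submodule.mkQ (Ideal.span (Set.range fun i => x i ^ t)))
      (Submodule.mkQ_surjective _)
    rw [Submodule.ker_mkQ, ht'] at h2
    have h3 : a ∈ (c.cl (R ⧸ Ideal.span (Set.range fun i => x i ^ t)) ⊥).comap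
        (Submodule.mkQ (Ideal.span (Set.range fun i => x i ^ t))) := by
      rw [Submodule.mem_comap, ha]
      exact h1
    rw [← h2] at h3
    apply hg
    rw [← ha]
    exact (Submodule.Quotient.mk_eq_zero _).mpr h3
  refine ⟨fun I => ?_, hM⟩
  have h := hr R (R ⧸ I) (Submodule.mkQ I) (Submodule.mkQ_surjective I)
  rwa [hM, Submodule.comap_bot, Submodule.ker_mkQ] at h

end Parameters

/-! ### Tight closure in characteristic `p` -/

section TightClosure

theorem mem_bracketPower {S : Type*} [CommRing S] {I : Ideal S} {a : S} (ha : a ∈ I) (q : ℕ) :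
    a ^ q ∈ bracketPower I q :=
  Ideal.subset_span ⟨a, ha, rfl⟩

theorem subset_tightClosure (p : ℕ) {S : Type*} [CommRing S] (I : Ideal S) :
    (I : Set S) ⊆ tightClosure p I := by
  intro u hu
  refine ⟨1, fun P hP h => ?_, 0, fun e _ => ?_⟩
  · have : P.IsPrime := hP.1.1
    exact this.ne_top ((Ideal.eq_top_iff_one P).mpr h)
  · rw [one_mul]
    exact mem_bracketPower hu _

theorem pow_mul_mem_bracketPower {S S' : Type*} [CommRing S] [CommRing S'] (f : S →+* S')
    {I : Ideal S} {J : Ideal S'} {y : S'} (h : ∀ a ∈ I, y * f a ∈ J) (q : ℕ) {v : S}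
    (hv : v ∈ bracketPower I q) : y ^ q * f v ∈ bracketPower J q := by
  induction hv using Submodule.span_induction with
  | mem v hv =>
    obtain ⟨a, ha, rfl⟩ := hv
    rw [map_pow, ← mul_pow]
    exact mem_bracketPower (h a ha) q
  | zero => simp
  | add v w _ _ hv hw =>
    rw [map_add, mul_add]
    exact Ideal.add_mem _ hv hw
  | smul r v _ hv =>
    rw [smul_eq_mul, map_mul, mul_left_comm]
    exact Ideal.mul_mem_left _ _ hv

/-- Tight closure is compatible with ring homomorphisms under which minimal primes contract to
minimal primes. -/
theorem mul_map_mem_tightClosure (p : ℕ) {S S' : Type*} [CommRing S] [CommRing S'] (f : S →+* S')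
    (hf : ∀ Q ∈ minimalPrimes S', Q.comap f ∈ minimalPrimes S)
    {I : Ideal S} {J : Ideal S'} {y : S'} (h : ∀ a ∈ I, y * f a ∈ J) {u : S}
    (hu : u ∈ tightClosure p I) : y * f u ∈ tightClosure p J := by
  obtain ⟨c, hc, e₀, he⟩ := hu
  refine ⟨f c, fun Q hQ hcQ => hc _ (hf Q hQ) hcQ, e₀, fun e hle => ?_⟩
  have h1 := pow_mul_mem_bracketPower f h (p ^ e) (he e hle)
  rw [map_mul, map_pow] at h1
  rw [mul_pow]
  convert h1 using 1
  ring

theorem mul_mem_tightClosure (p : ℕ) {S : Type*} [CommRing S] (I J : Ideal S) (y u : S)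
    (h : ∀ a ∈ I, y * a ∈ J) (hu : u ∈ tightClosure p I) : y * u ∈ tightClosure p J :=
  mul_map_mem_tightClosure p (RingHom.id S) (fun Q hQ => by simpa using hQ) h hu

theorem IsGorensteinLocal.tightClosure_eq {R : Type u} [CommRing R] [IsLocalRing R]
    [IsNoetherianRing R] (hR : IsGorensteinLocal R) (p : ℕ) {d : ℕ} {x : Fin d → R}
    (hx : IsSystemOfParameters R x)
    (hclosed : ∀ t, t ≠ 0 → tightClosure p (Ideal.span (Set.range fun i => x i ^ t)) ⊆
      (Ideal.span (Set.range fun i => x i ^ t) : Ideal R)) (I : Ideal R) :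
    tightClosure p I = I :=
  (hR.closure_subset (tightClosure p) (mul_mem_tightClosure p) hx
    (Set.Ioi_infinite 0) (fun t ht => hclosed t (Nat.pos_iff_ne_zero.mp ht)) I).antisymm
    (subset_tightClosure p I)

end TightClosure

/-! ### Tight closure in characteristic zero -/

section Zero

/-- The extension of a prime to a polynomial ring is prime, so a prime below the contraction of Q
extends to a prime below Q and equals Q by minimality; reading off constant coefficients brings the
equality back. This serves for the fibres D/μD → D'/μD', where the multiplier c must stay outside
all minimal primes. -/
theorem comap_quotientMap_C_mem_minimalPrimes {D : Type*} [CommRing D] {σ : Type*} (I : Ideal D)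
    (I' : Ideal (MvPolynomial σ D)) (hI' : I' = I.map MvPolynomial.C)
    (h : I ≤ I'.comap MvPolynomial.C) (Q : Ideal (MvPolynomial σ D ⧸ I'))
    (hQ : Q ∈ minimalPrimes (MvPolynomial σ D ⧸ I')) :
    Q.comap (Ideal.quotientMap I' MvPolynomial.C h) ∈ minimalPrimes (D ⧸ I) := by
  subst hI'
  have hQp : Q.IsPrime := hQ.1.1
  refine ⟨⟨Ideal.IsPrime.comap _, bot_le⟩, ?_⟩
  rintro p ⟨hp, -⟩ hle
  have hp0 : (p.comap (Ideal.Quotient.mk I)).IsPrime := Ideal.IsPrime.comap _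
  set p0 := p.comap (Ideal.Quotient.mk I) with hp0def
  let P' : Ideal (MvPolynomial σ D) := p0.map MvPolynomial.C
  have hP' : P'.IsPrime := by
    have : IsDomain (MvPolynomial σ (D ⧸ p0)) := inferInstance
    have e := MvPolynomial.quotientEquivQuotientMvPolynomial (σ := σ) p0
    rw [← Ideal.Quotient.isDomain_iff_prime]
    exact e.symm.toMulEquiv.isDomain _
  have hIP : I.map MvPolynomial.C ≤ P' := by
    refine Ideal.map_mono fun a ha => ?_
    rw [hp0def, Ideal.mem_comap, Ideal.Quotient.eq_zero_iff_mem.mpr ha]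
    exact p.zero_mem
  have hP'' : (P'.map (Ideal.Quotient.mk (I.map MvPolynomial.C))).IsPrime :=
    Ideal.map_isPrime_of_surjective Ideal.Quotient.mk_surjective (by rwa [Ideal.mk_ker])
  have hle' : P'.map (Ideal.Quotient.mk (I.map MvPolynomial.C)) ≤ Q := by
    rw [Ideal.map_le_iff_le_comap, Ideal.map_le_iff_le_comap]
    intro a ha
    have := hle ha
    simpa using this
  have hge := hQ.2 ⟨hP'', bot_le⟩ hle'
  intro z hz
  obtain ⟨z, rfl⟩ := Ideal.Quotient.mk_surjective z
  have h1 : Ideal.Quotient.mk (I.map MvPolynomial.C) (MvPolynomial.C z) ∈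
      P'.map (Ideal.Quotient.mk (I.map MvPolynomial.C)) := hge (by simpa using hz)
  have h2 : MvPolynomial.C z ∈ P' := by
    rw [← Ideal.mem_comap, Ideal.comap_map_of_surjective' _ Ideal.Quotient.mk_surjective,
      Ideal.mk_ker, sup_eq_left.mpr hIP] at h1
    exact h1
  have h3 := MvPolynomial.mem_map_C_iff.mp h2 0
  simpa [hp0def] using h3

/-- The model D of (I, u) need not contain preimages of y or of generators of J, so one variable is
adjoined for each. The ideal J' generated by Y·J₀ and the other variables expands to J, and on each
fibre the tight closure relation for t is multiplied by Y. -/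
theorem mul_mem_directTightClosure (K : Type v) [Field K] {C : Type u} [CommRing C]
    [IsNoetherianRing C] [Algebra K C] (I J : Ideal C) (y u : C) (h : ∀ a ∈ I, y * a ∈ J)
    (hu : u ∈ directTightClosure K I) : y * u ∈ directTightClosure K J := by
  obtain ⟨A, hA, D, _, _, _, φ, J₀, t, hJ₀, ht, a, ha, hμ⟩ := hu
  obtain ⟨n, b, hb⟩ := Submodule.fg_iff_exists_fin_generating_family.mp
    (IsNoetherian.noetherian J)
  let D' := MvPolynomial (Option (Fin n)) D
  let val : Option (Fin n) → C := fun o => o.elim y b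
  let φ' : D' →ₐ[A] C :=
    { MvPolynomial.eval₂Hom (φ : D →+* C) val with
      commutes' := fun r => by
        change MvPolynomial.eval₂Hom (φ : D →+* C) val (algebraMap A D' r) = _
        rw [IsScalarTower.algebraMap_apply A D D', MvPolynomial.algebraMap_eq,
          MvPolynomial.coe_eval₂Hom, MvPolynomial.eval₂_C]
        exact φ.commutes r }
  have hφC : ∀ d : D, φ' (MvPolynomial.C d) = φ d := fun d => MvPolynomial.eval₂_C _ _ _
  have hφX : ∀ o, φ' (MvPolynomial.X o) = val o := fun o => MvPolynomial.eval₂_X _ _ _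
  have hft : Algebra.FiniteType A D' := Algebra.FiniteType.trans (S := D) inferInstance inferInstance
  let S₁ : Set D' := (fun d => MvPolynomial.X none * MvPolynomial.C d) '' (J₀ : Set D)
  let S₂ : Set D' := Set.range fun i : Fin n => MvPolynomial.X (some i)
  let J' : Ideal D' := Ideal.span (S₁ ∪ S₂)
  refine ⟨A, hA, D', inferInstance, inferInstance, hft, φ', J',
    MvPolynomial.X none * MvPolynomial.C t, ?_, ?_, a, ha, ?_⟩
  · change Ideal.map φ' (Ideal.span (S₁ ∪ S₂)) = J
    rw [Ideal.map_span]
    apply le_antisymm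
    · rw [Ideal.span_le]
      rintro _ ⟨_, ⟨d, hd, rfl⟩ | ⟨i, rfl⟩, rfl⟩
      · rw [map_mul, hφC, hφX]
        refine h _ ?_
        rw [← hJ₀]
        exact Ideal.mem_map_of_mem _ hd
      · rw [hφX, ← hb]
        exact Submodule.subset_span ⟨i, rfl⟩
    · rw [← hb]
      refine Submodule.span_le.mpr ?_
      rintro _ ⟨i, rfl⟩
      exact Ideal.subset_span ⟨MvPolynomial.X (some i), Or.inr ⟨i, rfl⟩, hφX _⟩
  · rw [map_mul, hφC, hφX, ht]
    rfl
  · intro μ hμm haμ p hp hpμ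
    have hI' : μ.map (algebraMap A D') = (μ.map (algebraMap A D)).map MvPolynomial.C := by
      rw [Ideal.map_map]
      rfl
    have hle : μ.map (algebraMap A D) ≤ (μ.map (algebraMap A D')).comap MvPolynomial.C := by
      rw [hI']
      exact Ideal.le_comap_map
    have h1 := mul_map_mem_tightClosure p
      (Ideal.quotientMap (μ.map (algebraMap A D')) MvPolynomial.C hle)
      (fun Q hQ => comap_quotientMap_C_mem_minimalPrimes _ _ hI' hle Q hQ)
      (J := J'.map (Ideal.Quotient.mk (μ.map (algebraMap A D'))))
      (y := Ideal.Quotient.mk _ (MvPolynomial.X none)) (by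
        intro z hz
        rw [Ideal.mem_map_iff_of_surjective _ Ideal.Quotient.mk_surjective] at hz
        obtain ⟨d, hd, rfl⟩ := hz
        rw [Ideal.quotientMap_mk, ← map_mul]
        exact Ideal.mem_map_of_mem _ (Ideal.subset_span (Or.inl ⟨d, hd, rfl⟩)))
      (hμ μ hμm haμ p hp hpμ)
    rw [Ideal.quotientMap_mk, ← map_mul] at h1
    exact h1

theorem one_mem_directTightClosure_top (K : Type v) [Field K] [CharZero K] (C : Type u) [CommRing C]
    [Algebra K C] : (1 : C) ∈ directTightClosure K (⊤ : Ideal C) := by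
  -- The model D must live in `Type`, so ℤ is used as an algebra over its copy in K; characteristic
  -- zero makes the two isomorphic.
  let e : (⊥ : Subalgebra ℤ K) ≃ₐ[ℤ] ℤ := Algebra.botEquivOfInjective (algebraMap ℤ K).injective_int
  let _ : Algebra (⊥ : Subalgebra ℤ K) ℤ := (e : (⊥ : Subalgebra ℤ K) →+* ℤ).toAlgebra
  have hsurj : Function.Surjective (algebraMap (⊥ : Subalgebra ℤ K) ℤ) := e.surjective
  refine ⟨⊥, Subalgebra.fg_bot, ℤ, inferInstance, inferInstance,
    Algebra.FiniteType.of_surjective (Algebra.ofId _ _) hsurj,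
    { Int.castRingHom C with
      commutes' := fun r => by
        obtain ⟨n, rfl⟩ := e.symm.surjective r
        have h1 : e.symm n = algebraMap ℤ (⊥ : Subalgebra ℤ K) n := e.symm.commutes n
        have h2 : algebraMap (⊥ : Subalgebra ℤ K) ℤ (e.symm n) = n := e.apply_symm_apply n
        rw [h2, h1, eq_intCast, map_intCast]
        rfl }, ⊤, 1, Ideal.map_top _, map_one _, 1, one_ne_zero, ?_⟩
  intro μ _ _ p _ _
  exact subset_tightClosure p _ (by rw [Ideal.map_top]; trivial)

/-- Writing w = w·1 reduces the inclusion to the membership of 1 in the closure of the unit ideal,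
by compatibility with multiplication. -/
theorem subset_zeroTightClosure (K : Type v) [Field K] [CharZero K] {R : Type u} [CommRing R]
    [IsNoetherianRing R] [Algebra K R] (I : Ideal R) : (I : Set R) ⊆ zeroTightClosure K I := by
  intro w hw P _
  have := mul_mem_directTightClosure K ⊤ (I.map (Ideal.Quotient.mk P)) (Ideal.Quotient.mk P w) 1
    (fun a _ => Ideal.mul_mem_right _ _ (Ideal.mem_map_of_mem _ hw))
    (one_mem_directTightClosure_top K (R ⧸ P))
  rwa [mul_one] at this

theorem mul_mem_zeroTightClosure (K : Type v) [Field K] {R : Type u} [CommRing R]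
    [IsNoetherianRing R] [Algebra K R] (I J : Ideal R) (y u : R) (h : ∀ a ∈ I, y * a ∈ J)
    (hu : u ∈ zeroTightClosure K I) : y * u ∈ zeroTightClosure K J := by
  intro P hP
  rw [map_mul]
  refine mul_mem_directTightClosure K _ _ _ _ (fun z hz => ?_) (hu P hP)
  rw [Ideal.mem_map_iff_of_surjective _ Ideal.Quotient.mk_surjective] at hz
  obtain ⟨a, ha, rfl⟩ := hz
  rw [← map_mul]
  exact Ideal.mem_map_of_mem _ (h a ha)

theorem IsGorensteinLocal.isFRegularZero {R : Type u} [CommRing R] [IsLocalRing R]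
    [IsNoetherianRing R] (hR : IsGorensteinLocal R) (K : Type v) [Field K] [CharZero K]
    [Algebra K R] (h : IsFRationalZero K R) : IsFRegularZero K R := by
  intro I
  obtain ⟨d, x, hx⟩ := hR.exists_isSystemOfParameters
  refine (hR.closure_subset (zeroTightClosure K) (mul_mem_zeroTightClosure K) hx
    (Set.Ioi_infinite 0) (fun t ht => ?_) I).antisymm (subset_zeroTightClosure K I)
  exact (h d _ (hx.pow (Nat.pos_iff_ne_zero.mp ht))).le

end Zero

end FSing

namespace FSing

open RingTheory.Sequence IsLocalRing

/-! ### Localization of Gorenstein rings -/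

section Localization

/-- Prime avoidance: an element of all primes in `A` and of no prime in `B`. -/
theorem exists_mem_forall_notMem {S : Type*} [CommRing S] {A B : Set (Ideal S)} (hA : A.Finite)
    (hB : B.Finite) (hBp : ∀ Q ∈ B, Q.IsPrime) (h : ∀ P ∈ A, ∀ Q ∈ B, ¬ P ≤ Q) :
    ∃ r, (∀ P ∈ A, r ∈ P) ∧ ∀ Q ∈ B, r ∉ Q := by
  classical
  have h1 : ¬ ((hA.toFinset.inf id : Ideal S) : Set S) ⊆
      ⋃ Q ∈ (hB.toFinset : Set (Ideal S)), (Q : Set S) := by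
    rw [Ideal.subset_union_prime ⊥ ⊥ (fun Q hQ _ _ => hBp Q (hB.mem_toFinset.mp hQ))]
    rintro ⟨Q, hQ, hle⟩
    rw [Set.Finite.mem_toFinset] at hQ
    obtain ⟨P, hP, hPQ⟩ := (Ideal.IsPrime.inf_le' (hBp Q hQ)).mp hle
    exact h P (hA.mem_toFinset.mp hP) Q hQ hPQ
  obtain ⟨r, hr, hr'⟩ := Set.not_subset.mp h1
  refine ⟨r, fun P hP => ?_, fun Q hQ hrQ => hr' ?_⟩
  · exact (Finset.inf_le (f := id) (hA.mem_toFinset.mpr hP) : _ ≤ P) hr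
  · exact Set.mem_biUnion (by simpa using hQ) hrQ

/-- If the image of `c` in a localization at a prime is outside all minimal primes, then it is also
the image of an element outside all minimal primes. -/
theorem exists_lift_forall_notMem_minimalPrimes {S : Type*} [CommRing S] [IsNoetherianRing S]
    (P : Ideal S) [P.IsPrime] {c : S}
    (hc : ∀ Q ∈ minimalPrimes (Localization.AtPrime P),
      algebraMap S (Localization.AtPrime P) c ∉ Q) :
    ∃ c', algebraMap S (Localization.AtPrime P) c' = algebraMap S (Localization.AtPrime P) c ∧
      ∀ Q ∈ minimalPrimes S, c' ∉ Q := by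
  have hfin : (minimalPrimes S).Finite := Ideal.finite_minimalPrimes_of_isNoetherianRing S ⊥
  -- δ lies in exactly those minimal primes that miss c. All minimal primes of the localization
  -- contract to such primes, so δ becomes nilpotent there.
  obtain ⟨δ, hδ1, hδ2⟩ := exists_mem_forall_notMem (A := {Q ∈ minimalPrimes S | c ∉ Q})
    (B := {Q ∈ minimalPrimes S | c ∈ Q}) (hfin.subset (Set.sep_subset _ _))
    (hfin.subset (Set.sep_subset _ _)) (fun Q hQ => hQ.1.1.1) (by
      rintro Q ⟨hQ, hcQ⟩ Q' ⟨hQ', hcQ'⟩ hle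
      exact hcQ (hQ'.2 hQ.1 hle hcQ'))
  have hmap : minimalPrimes (Localization.AtPrime P) = Ideal.under S ⁻¹' minimalPrimes S := by
    have := IsLocalization.minimalPrimes_map P.primeCompl (Localization.AtPrime P) (⊥ : Ideal S)
    rwa [Ideal.map_bot] at this
  have hnil : IsNilpotent (algebraMap S (Localization.AtPrime P) δ) := by
    rw [nilpotent_iff_mem_prime]
    intro J hJ
    obtain ⟨Q, hQ, hQJ⟩ := Ideal.exists_minimalPrimes_le (bot_le : ⊥ ≤ J)
    refine hQJ ?_
    have h1 : Q.under S ∈ minimalPrimes S := by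
      have : Q ∈ minimalPrimes (Localization.AtPrime P) := hQ
      rwa [hmap] at this
    exact hδ1 (Q.under S) ⟨h1, fun h => hc Q hQ h⟩
  obtain ⟨n, hn⟩ := hnil
  -- Each minimal prime contains exactly one of the two summands; the exponent n + 1 is positive so
  -- that the power stays in the primes containing δ.
  refine ⟨c + δ ^ (n + 1), ?_, fun Q hQ hmem => ?_⟩
  · rw [map_add, map_pow, pow_succ, hn, zero_mul, add_zero]
  · have hQp : Q.IsPrime := hQ.1.1
    by_cases hcQ : c ∈ Q
    · exact hδ2 Q ⟨hQ, hcQ⟩ (hQp.mem_of_pow_mem _ ((Ideal.add_mem_iff_right Q hcQ).mp hmem))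
    · exact hcQ ((Ideal.add_mem_iff_left Q
        (Ideal.pow_mem_of_mem Q (hδ1 Q ⟨hQ, hcQ⟩) _ n.succ_pos)).mp hmem)

variable {R : Type u} [CommRing R] [IsLocalRing R] [IsNoetherianRing R]

/-- Over a Noetherian ring, localizing a module does not raise its injective dimension. -/
theorem IsGorensteinLocal.localization (hR : IsGorensteinLocal R) (P : Ideal R) [P.IsPrime] :
    IsGorensteinLocal (Localization.AtPrime P) := by
  obtain ⟨n, hn⟩ := hR
  refine ⟨n, ?_⟩
  have h1 := ModuleCat.localizedModule_hasInjectiveDimensionLE n P.primeCompl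
    (ModuleCat.of.{u} R R)
  have := ModuleCat.localizedModule_isLocalizedModule (ModuleCat.of.{u} R R) P.primeCompl
  have e : (ModuleCat.of.{u} R R).localizedModule P.primeCompl ≃ₗ[R] Localization.AtPrime P :=
    IsLocalizedModule.linearEquiv P.primeCompl
      ((ModuleCat.of.{u} R R).localizedModuleMkLinearMap P.primeCompl)
      (Algebra.linearMap R (Localization.AtPrime P))
  exact (ModuleCat.hasInjectiveDimensionLE_iff_of_linearEquiv
    (N := ModuleCat.of.{u} (Localization.AtPrime P) (Localization.AtPrime P))
    (e.extendScalarsOfIsLocalization P.primeCompl (Localization.AtPrime P)) n).mp h1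

/-- The associated primes of the quotient of a Gorenstein ring by a regular sequence are minimal. -/
theorem IsGorensteinLocal.mem_minimalPrimes (hR : IsGorensteinLocal R) {rs : List R}
    (reg : IsWeaklyRegular R rs) {Q : Ideal R}
    (hQ : IsAssociatedPrime Q (R ⧸ Ideal.ofList rs)) : Q ∈ (Ideal.ofList rs).minimalPrimes := by
  obtain ⟨hQp, x, hx⟩ := isAssociatedPrime_iff.mp hQ
  obtain ⟨a, rfl⟩ := Ideal.Quotient.mk_surjective x
  have hmem : ∀ r, r ∈ Q ↔ r * a ∈ Ideal.ofList rs := by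
    intro r
    rw [hx, Submodule.mem_colon_singleton, Submodule.mem_bot, Algebra.smul_def,
      Ideal.Quotient.algebraMap_eq, ← map_mul, Ideal.Quotient.eq_zero_iff_mem]
  have hle : Ideal.ofList rs ≤ Q := fun r hr => (hmem r).mpr (Ideal.mul_mem_right _ _ hr)
  have hrs : ∀ r ∈ rs, r ∈ Q := fun r hr => hle (Ideal.subset_span hr)
  set f := algebraMap R (Localization.AtPrime Q) with hf
  have reg' := reg.isRegular_of_isLocalization_of_mem (Localization.AtPrime Q) Q hrs
  -- The annihilator relation for Q survives localization at Q. As R_Q is Gorenstein, (rs)R_Q is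
  -- then primary to QR_Q, so no prime containing (rs) lies strictly below Q.
  have hass : IsAssociatedPrime (maximalIdeal (Localization.AtPrime Q))
      (Localization.AtPrime Q ⧸ Ideal.ofList (rs.map f)) := by
    rw [isAssociatedPrime_iff]
    refine ⟨inferInstance, Ideal.Quotient.mk _ (f a), ?_⟩
    refine (maximalIdeal.isMaximal _).eq_of_le (fun h => ?_) ?_
    · rw [Ideal.eq_top_iff_one, Submodule.mem_colon_singleton, one_smul, Submodule.mem_bot,
        Ideal.Quotient.eq_zero_iff_mem, ← Ideal.map_ofList,
        IsLocalization.algebraMap_mem_map_algebraMap_iff Q.primeCompl] at h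
      obtain ⟨s, hs, hsa⟩ := h
      exact hs ((hmem s).mpr hsa)
    · rw [← Localization.AtPrime.map_eq_maximalIdeal, Ideal.map_le_iff_le_comap]
      intro r hr
      rw [Ideal.mem_comap, Submodule.mem_colon_singleton, Submodule.mem_bot]
      change Ideal.Quotient.mk _ (f r * f a) = 0
      rw [Ideal.Quotient.eq_zero_iff_mem, ← map_mul, ← Ideal.map_ofList]
      exact Ideal.mem_map_of_mem _ ((hmem r).mp hr)
  have hrad := ((hR.localization Q).extVanishing_and_radical reg' hass).2
  refine ⟨⟨hQp, hle⟩, fun Q' ⟨hQ', hle'⟩ hQQ r hr => ?_⟩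
  have h1 : f r ∈ (Ideal.ofList (rs.map f)).radical := by
    rw [hrad, ← Localization.AtPrime.map_eq_maximalIdeal]
    exact Ideal.mem_map_of_mem _ hr
  obtain ⟨n, hn⟩ := h1
  rw [← map_pow, ← Ideal.map_ofList,
    IsLocalization.algebraMap_mem_map_algebraMap_iff Q.primeCompl] at hn
  obtain ⟨s, hs, hsr⟩ := hn
  rcases hQ'.mem_or_mem (hle' hsr) with h | h
  · exact absurd (hQQ h) hs
  · exact hQ'.mem_of_pow_mem _ h

/-! ### Powers of regular sequences and tight closure in localizations -/

theorem radical_ofList_map_pow {S : Type*} [CommRing S] (xs : List S) {q : ℕ}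
    (hq : q ≠ 0) : (Ideal.ofList (xs.map fun x => x ^ q)).radical = (Ideal.ofList xs).radical := by
  apply le_antisymm
  · refine Ideal.radical_mono (Ideal.span_le.mpr fun r hr => ?_)
    obtain ⟨x, hx, rfl⟩ := List.mem_map.mp hr
    exact Ideal.pow_mem_of_mem (Ideal.ofList xs) (Ideal.subset_span (s := {r | r ∈ xs}) hx) q
      (Nat.pos_of_ne_zero hq)
  · rw [Ideal.radical_le_radical_iff, Ideal.span_le]
    intro x hx
    exact Ideal.mem_radical_of_pow_mem (m := q)
      (Ideal.le_radical (Ideal.subset_span (List.mem_map.mpr ⟨x, hx, rfl⟩)))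

/-- Extend the sequence to a full system of parameters; its powers are again a system of parameters,
hence regular, and an initial segment of a regular sequence is weakly regular. -/
theorem IsGorensteinLocal.isWeaklyRegular_map_pow (hR : IsGorensteinLocal R) {xs : List R}
    (hxs : ∀ r ∈ xs, r ∈ maximalIdeal R) (reg : IsWeaklyRegular R xs) {q : ℕ} (hq : q ≠ 0) :
    IsWeaklyRegular R (xs.map (· ^ q)) := by
  obtain ⟨ys, -, -, -, hrad, hdim⟩ := hR.exists_append xs hxs reg
  have h := (hR.isRegular_of_radical (xs := (xs ++ ys).map (· ^ q)) (by simpa using hdim)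
    (by rw [radical_ofList_map_pow _ hq, hrad])).1.toIsWeaklyRegular
  rw [List.map_append, isWeaklyRegular_append_iff] at h
  exact h.1

theorem minimalPrimes_eq_of_radical_eq {S : Type*} [CommRing S] {I J : Ideal S}
    (h : I.radical = J.radical) : I.minimalPrimes = J.minimalPrimes := by
  rw [← Ideal.radical_minimalPrimes, h, Ideal.radical_minimalPrimes]

/-- For a minimal prime `P` over a regular sequence `x`, a single element `s ∉ P` controls the
contraction to `R` of the ideals `(x^q) R_P`. -/
theorem IsGorensteinLocal.exists_pow_mul_mem (hR : IsGorensteinLocal R) {xs : List R}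
    (hxs : ∀ r ∈ xs, r ∈ maximalIdeal R) (reg : IsWeaklyRegular R xs) {P : Ideal R}
    (hP : P ∈ (Ideal.ofList xs).minimalPrimes) (p : ℕ) [Fact p.Prime] [CharP R p] :
    ∃ s, s ∉ P ∧ ∀ (e : ℕ) (s' v : R), s' ∉ P → s' * v ∈ bracketPower (Ideal.ofList xs) (p ^ e) →
      s ^ p ^ e * v ∈ bracketPower (Ideal.ofList xs) (p ^ e) := by
  have hPp : P.IsPrime := hP.1.1
  have hfin := Ideal.finite_minimalPrimes_of_isNoetherianRing R (Ideal.ofList xs)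
  obtain ⟨s₀, hs1, hs2⟩ := exists_mem_forall_notMem
    (A := (Ideal.ofList xs).minimalPrimes \ {P}) (B := {P}) (hfin.subset Set.sdiff_subset)
    (Set.finite_singleton P) (by rintro _ rfl; exact hPp) (by
      rintro Q ⟨hQ, hne⟩ _ rfl hle
      exact hne (le_antisymm hle (hP.2 hQ.1 hle)))
  obtain ⟨y₀, hy1, hy2⟩ := exists_mem_forall_notMem
    (A := {P}) (B := (Ideal.ofList xs).minimalPrimes \ {P}) (Set.finite_singleton P)
    (hfin.subset Set.sdiff_subset) (fun Q hQ => hQ.1.1.1) (by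
      rintro _ rfl Q ⟨hQ, hne⟩ hle
      exact hne (le_antisymm (hQ.2 hP.1 hle) hle))
  have hrad : s₀ * y₀ ∈ (Ideal.ofList xs).radical := by
    rw [← Ideal.sInf_minimalPrimes, Submodule.mem_sInf]
    intro Q hQ
    by_cases hQP : Q = P
    · exact hQP ▸ Ideal.mul_mem_left _ _ (hy1 P rfl)
    · exact Ideal.mul_mem_right _ _ (hs1 Q ⟨hQ, hQP⟩)
  obtain ⟨N, hN⟩ := hrad
  have hN1 : (s₀ ^ (N + 1)) * (y₀ ^ (N + 1)) ∈ Ideal.ofList xs := by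
    rw [← mul_pow, pow_succ]
    exact Ideal.mul_mem_right _ _ hN
  refine ⟨s₀ ^ (N + 1), fun h => hs2 P rfl (hPp.mem_of_pow_mem _ h), fun e s' v hs' hv => ?_⟩
  set s := s₀ ^ (N + 1)
  set y := y₀ ^ (N + 1)
  have hq : p ^ e ≠ 0 := pow_ne_zero _ (Fact.out : p.Prime).ne_zero
  -- The bracket power is the extension along the iterated Frobenius, so it is generated by the
  -- powers of the generators.
  have hb : bracketPower (Ideal.ofList xs) (p ^ e) = Ideal.ofList (xs.map (· ^ p ^ e)) :=
    Ideal.map_ofList (iterateFrobenius R p e) xs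
  -- With q = p^e, the element s's^q + y^q is a nonzerodivisor modulo (x^q): the associated primes
  -- are the minimal primes of (x), and each contains exactly one summand. It multiplies s^q·v into
  -- (x^q), since s'v ∈ (x)^[q] and sy ∈ (x).
  have hz : ∀ Q ∈ associatedPrimes R (R ⧸ Ideal.ofList (xs.map (· ^ p ^ e))),
      s' * s ^ p ^ e + y ^ p ^ e ∉ Q := by
    intro Q hQ hmem
    have hQ' := hR.mem_minimalPrimes (hR.isWeaklyRegular_map_pow hxs reg hq) hQ
    rw [minimalPrimes_eq_of_radical_eq (radical_ofList_map_pow xs hq)] at hQ'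
    have hQp : Q.IsPrime := hQ'.1.1
    by_cases hQP : Q = P
    · subst hQP
      have h1 : y ^ p ^ e ∈ Q := Ideal.pow_mem_of_mem _
        (Ideal.pow_mem_of_mem _ (hy1 Q rfl) _ N.succ_pos) _ (Nat.pos_of_ne_zero hq)
      rcases hQp.mem_or_mem ((Ideal.add_mem_iff_left Q h1).mp hmem) with h | h
      · exact hs' h
      · exact hs2 Q rfl (hQp.mem_of_pow_mem _ (hQp.mem_of_pow_mem _ h))
    · have h1 : s' * s ^ p ^ e ∈ Q := Ideal.mul_mem_left _ _ (Ideal.pow_mem_of_mem _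
        (Ideal.pow_mem_of_mem _ (hs1 Q ⟨hQ', hQP⟩) _ N.succ_pos) _ (Nat.pos_of_ne_zero hq))
      exact hy2 Q ⟨hQ', hQP⟩ (hQp.mem_of_pow_mem _ (hQp.mem_of_pow_mem _
        ((Ideal.add_mem_iff_right Q h1).mp hmem)))
  have hyz : (s' * s ^ p ^ e + y ^ p ^ e) * (s ^ p ^ e * v) ∈
      bracketPower (Ideal.ofList xs) (p ^ e) := by
    have h1 := mem_bracketPower hN1 (p ^ e)
    have h2 : (s' * s ^ p ^ e + y ^ p ^ e) * (s ^ p ^ e * v) =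
        (s ^ p ^ e * s ^ p ^ e) * (s' * v) + v * (s * y) ^ p ^ e := by
      rw [mul_pow]
      ring
    rw [h2]
    exact Ideal.add_mem _ (Ideal.mul_mem_left _ _ hv) (Ideal.mul_mem_left _ _ h1)
  rw [hb] at hyz ⊢
  by_contra hne
  have h3 : s' * s ^ p ^ e + y ^ p ^ e ∈
      ⋃ Q ∈ associatedPrimes R (R ⧸ Ideal.ofList (xs.map (· ^ p ^ e))), (Q : Set R) := by
    rw [biUnion_associatedPrimes_eq_zero_divisors]
    refine ⟨Ideal.Quotient.mk _ (s ^ p ^ e * v), ?_, ?_⟩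
    · rwa [Ne, Ideal.Quotient.eq_zero_iff_mem]
    · rwa [Algebra.smul_def, Ideal.Quotient.algebraMap_eq, ← map_mul,
        Ideal.Quotient.eq_zero_iff_mem]
  obtain ⟨Q, hQ, h4⟩ := Set.mem_iUnion₂.mp h3
  exact hz Q hQ h4

/-- If all ideals of a Gorenstein local ring are tightly closed, the expansion to `R_P` of an ideal
generated by a regular sequence is tightly closed for a minimal prime `P` of this ideal. -/
theorem IsGorensteinLocal.tightClosure_map_subset (hR : IsGorensteinLocal R) (p : ℕ)
    [Fact p.Prime] [CharP R p] (hcl : ∀ I : Ideal R, tightClosure p I = (I : Set R)) {xs : List R}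
    (hxs : ∀ r ∈ xs, r ∈ maximalIdeal R) (reg : IsWeaklyRegular R xs) {P : Ideal R} [P.IsPrime]
    (hP : P ∈ (Ideal.ofList xs).minimalPrimes) :
    tightClosure p ((Ideal.ofList xs).map (algebraMap R (Localization.AtPrime P))) ⊆
      ((Ideal.ofList xs).map (algebraMap R (Localization.AtPrime P)) : Ideal _) := by
  rintro u ⟨c, hc, e₀, he⟩
  have hp : p.Prime := Fact.out
  have hchar : CharP (Localization.AtPrime P) p := by
    rw [CharP.charP_iff_prime_eq_zero hp, ← map_natCast (algebraMap R _), CharP.cast_eq_zero,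
      map_zero]
  obtain ⟨s, hs, hW⟩ := hR.exists_pow_mul_mem hxs reg hP p
  set f := algebraMap R (Localization.AtPrime P) with hf
  obtain ⟨⟨a, s₁⟩, ha⟩ := IsLocalization.surj P.primeCompl u
  obtain ⟨⟨c₀, s₂⟩, hc₀⟩ := IsLocalization.surj P.primeCompl c
  simp only at ha hc₀
  obtain ⟨c', hc'1, hc'2⟩ := exists_lift_forall_notMem_minimalPrimes P (c := c₀) (by
    intro Q hQ h
    have hQp : Q.IsPrime := hQ.1.1
    rw [← hc₀] at h
    rcases hQp.mem_or_mem h with h | h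
    · exact hc Q hQ h
    · exact hQp.ne_top (Ideal.eq_top_of_isUnit_mem _ h (IsLocalization.map_units _ s₂)))
  have hbr : ∀ e, bracketPower ((Ideal.ofList xs).map f) (p ^ e) =
      (bracketPower (Ideal.ofList xs) (p ^ e)).map f := by
    intro e
    change Ideal.map (iterateFrobenius _ p e) (Ideal.map f _) =
      Ideal.map f (Ideal.map (iterateFrobenius _ p e) _)
    rw [Ideal.map_map, Ideal.map_map]
    congr 1
    ext r
    simp [iterateFrobenius_def]
  -- Clearing denominators in the relation over R_P costs some s' depending on e; it is replaced by
  -- s^q, which is absorbed into (sa)^q.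
  have hsa : s * a ∈ tightClosure p (Ideal.ofList xs) := by
    refine ⟨c', hc'2, e₀, fun e hle => ?_⟩
    have h1 := he e hle
    have h2 : f (c' * a ^ p ^ e) ∈ (bracketPower (Ideal.ofList xs) (p ^ e)).map f := by
      have h3 : f (c' * a ^ p ^ e) = (f s₂ * (f s₁) ^ p ^ e) * (c * u ^ p ^ e) := by
        rw [map_mul, map_pow, hc'1, ← ha, ← hc₀]
        ring
      rw [h3, ← hbr]
      exact Ideal.mul_mem_left _ _ h1
    rw [IsLocalization.algebraMap_mem_map_algebraMap_iff P.primeCompl] at h2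
    obtain ⟨s', hs', h4⟩ := h2
    have h5 := hW e s' _ hs' h4
    rw [mul_pow]
    convert h5 using 1
    ring
  rw [hcl] at hsa
  have h6 : f a ∈ (Ideal.ofList xs).map f := by
    rw [IsLocalization.algebraMap_mem_map_algebraMap_iff P.primeCompl]
    exact ⟨s, hs, hsa⟩
  rw [← ha] at h6
  exact (Ideal.mul_unit_mem_iff_mem _ (IsLocalization.map_units _ s₁)).mp h6

/-- For Gorenstein local rings of prime characteristic, `F`-rational implies `F`-regular. -/
theorem IsGorensteinLocal.isFRegular (hR : IsGorensteinLocal R) (p : ℕ) [Fact p.Prime] [CharP R p]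
    (h : IsFRational p R) : IsFRegular p R := by
  have hcl : ∀ I : Ideal R, tightClosure p I = (I : Set R) := by
    obtain ⟨d, x, hx⟩ := hR.exists_isSystemOfParameters
    exact hR.tightClosure_eq p hx fun t ht => (h d _ (hx.pow ht)).subset
  refine ⟨hcl, fun P hP I => ?_⟩
  -- A maximal regular sequence inside P; unmixedness makes P minimal over it, so its image is a
  -- system of parameters of R_P.
  obtain ⟨xs, hxs, reg, Q, hQ, hPQ⟩ := exists_maximal_isRegular (le_maximalIdeal hP.ne_top) []
    (by simp) (by simp)
  rw [List.nil_append] at hxs reg hQ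
  have hQ' := hR.mem_minimalPrimes reg.toIsWeaklyRegular hQ
  have hle : Ideal.ofList xs ≤ P := Ideal.span_le.mpr hxs
  obtain rfl : P = Q := le_antisymm hPQ (hQ'.2 ⟨hP, hle⟩ hPQ)
  have hxm : ∀ r ∈ xs, r ∈ maximalIdeal R := fun r hr => le_maximalIdeal hP.ne_top (hxs r hr)
  set f := algebraMap R (Localization.AtPrime P) with hf
  have reg' := reg.toIsWeaklyRegular.isRegular_of_isLocalization_of_mem
    (Localization.AtPrime P) P hxs
  have hrad : (Ideal.ofList (xs.map f)).radical = maximalIdeal (Localization.AtPrime P) := by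
    apply le_antisymm
    · rw [(maximalIdeal.isMaximal _).isPrime.radical_le_iff, ← Ideal.map_ofList,
        ← Localization.AtPrime.map_eq_maximalIdeal]
      exact Ideal.map_mono hle
    · rw [← Ideal.sInf_minimalPrimes, ← Ideal.map_ofList,
        IsLocalization.minimalPrimes_map P.primeCompl]
      refine le_sInf fun J hJ => ?_
      have hJ' : J.under R ∈ (Ideal.ofList xs).minimalPrimes := hJ
      have hJp : J.IsPrime := by
        have h2 : J ∈ ((Ideal.ofList xs).map f).minimalPrimes := by
          rw [IsLocalization.minimalPrimes_map P.primeCompl]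
          exact hJ
        exact h2.1.1
      rw [← Localization.AtPrime.map_eq_maximalIdeal, Ideal.map_le_iff_le_comap]
      refine hQ'.2 hJ'.1 ?_
      have h3 : J.under R ≤ (maximalIdeal (Localization.AtPrime P)).under R :=
        Ideal.comap_mono (le_maximalIdeal hJp.ne_top)
      rwa [IsLocalization.AtPrime.under_maximalIdeal (Localization.AtPrime P) P] at h3
  have hspan : ∀ t : ℕ, Ideal.span (Set.range fun i : Fin xs.length => f xs[i] ^ t) =
      (Ideal.ofList (xs.map (· ^ t))).map f := by
    intro t
    rw [← ofList_ofFn, Ideal.map_ofList, List.map_map]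
    congr 1
    apply List.ext_getElem <;> simp
  have hdim : ringKrullDim (Localization.AtPrime P) = xs.length := by
    rw [← ringKrullDim_add_length_eq_ringKrullDim_of_isRegular _ reg',
      ringKrullDim_quotient_eq_zero hrad, zero_add, List.length_map]
  have hx : IsSystemOfParameters (Localization.AtPrime P) fun i : Fin xs.length => f xs[i] := by
    refine ⟨hdim, ?_⟩
    have := hspan 1
    simp only [pow_one, List.map_id'] at this
    rw [this, Ideal.map_ofList, hrad]
  refine (hR.localization P).tightClosure_eq p hx (fun t ht => ?_) I
  rw [hspan]
  refine hR.tightClosure_map_subset p hcl ?_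
    (hR.isWeaklyRegular_map_pow hxm reg.toIsWeaklyRegular ht) ?_
  · intro r hr
    obtain ⟨x, hx, rfl⟩ := List.mem_map.mp hr
    exact Ideal.pow_mem_of_mem _ (hxm x hx) t (Nat.pos_of_ne_zero ht)
  · rwa [minimalPrimes_eq_of_radical_eq (radical_ofList_map_pow xs ht)]

end Localization

end FSing

namespace FSing

/-! ### Morphisms out of left derived functors -/

section LeftDerived

universe w₁ w₂ w₃ w₄

variable {D : Type w₃} [Category.{w₄} D] [Abelian D]

/-- The morphism out of the homology of a chain complex given by a cocycle. -/
noncomputable def homologyDesc (K : ChainComplex D ℕ) (n : ℕ) {A : D} (φ : K.X n ⟶ A)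
    (hφ : K.d (n + 1) n ≫ φ = 0) :
    (HomologicalComplex.homologyFunctor D (ComplexShape.down ℕ) n).obj K ⟶ A :=
  K.homologyι n ≫ K.descOpcycles φ (n + 1) (by simp) hφ

theorem homologyMap_comp_homologyDesc {K L : ChainComplex D ℕ} (g : K ⟶ L) (n : ℕ) {A : D}
    (φ : L.X n ⟶ A) (hφ : L.d (n + 1) n ≫ φ = 0) (hφ' : K.d (n + 1) n ≫ g.f n ≫ φ = 0) :
    (HomologicalComplex.homologyFunctor D (ComplexShape.down ℕ) n).map g ≫ homologyDesc L n φ hφ =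
      homologyDesc K n (g.f n ≫ φ) hφ' := by
  change HomologicalComplex.homologyMap g n ≫ L.homologyι n ≫ L.descOpcycles φ (n + 1) _ hφ =
    K.homologyι n ≫ K.descOpcycles (g.f n ≫ φ) (n + 1) _ hφ'
  rw [HomologicalComplex.homologyι_naturality_assoc,
    HomologicalComplex.opcyclesMap_comp_descOpcycles]

/-- Homology is the kernel of the map from opcycles to the next term, so a morphism on opcycles
vanishing on it extends to the next term because A is injective. -/
theorem homologyDesc_eq_zero_iff (K : ChainComplex D ℕ) (n : ℕ) {A : D} [Injective A]
    (φ : K.X n ⟶ A) (hφ : K.d (n + 1) n ≫ φ = 0) :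
    homologyDesc K n φ hφ = 0 ↔
      ∃ ψ : K.X ((ComplexShape.down ℕ).next n) ⟶ A, K.d n _ ≫ ψ = φ := by
  constructor
  · intro h
    have hex : (ShortComplex.mk (K.homologyι n)
        (K.fromOpcycles n ((ComplexShape.down ℕ).next n))
        (K.homologyι_comp_fromOpcycles _ _)).Exact :=
      ShortComplex.exact_of_f_is_kernel _ (K.homologyIsKernel n _ rfl)
    refine ⟨hex.descToInjective _ h, ?_⟩
    have h2 : K.fromOpcycles n _ ≫ hex.descToInjective _ h =
      K.descOpcycles φ (n + 1) (by simp) hφ := hex.comp_descToInjective _ h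
    rw [← K.p_fromOpcycles, Category.assoc, h2, K.p_descOpcycles]
  · rintro ⟨ψ, rfl⟩
    exact K.homologyι_descOpcycles_eq_zero_of_boundary _ (n + 1) (by simp) ψ rfl

variable {C : Type w₁} [Category.{w₂} C] [Abelian C] [HasProjectiveResolutions C]

/-- The complex computing the left derived functors of `F` from a projective resolution. -/
noncomputable abbrev derivedComplex {X : C} (P : ProjectiveResolution X) (F : C ⥤ D)
    [F.Additive] : ChainComplex D ℕ :=
  (F.mapHomologicalComplex (ComplexShape.down ℕ)).obj P.complex

/-- The morphism out of a left derived functor given by a cocycle on a projective resolution. -/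
noncomputable def leftDerivedDesc {X : C} (P : ProjectiveResolution X) (F : C ⥤ D) [F.Additive]
    (n : ℕ) {A : D} (φ : (derivedComplex P F).X n ⟶ A)
    (hφ : (derivedComplex P F).d (n + 1) n ≫ φ = 0) : (F.leftDerived n).obj X ⟶ A :=
  (P.isoLeftDerivedObj F n).hom ≫ homologyDesc (derivedComplex P F) n φ hφ

theorem leftDerived_map_comp_desc {X X' : C} (f : X ⟶ X') (P : ProjectiveResolution X)
    (P' : ProjectiveResolution X') (g : ProjectiveResolution.Hom P P' f) (F : C ⥤ D) [F.Additive]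
    (n : ℕ) {A : D} (φ : (derivedComplex P' F).X n ⟶ A)
    (hφ : (derivedComplex P' F).d (n + 1) n ≫ φ = 0)
    (hφ' : (derivedComplex P F).d (n + 1) n ≫
      ((F.mapHomologicalComplex (ComplexShape.down ℕ)).map g.hom).f n ≫ φ = 0) :
    (F.leftDerived n).map f ≫ leftDerivedDesc P' F n φ hφ =
      leftDerivedDesc P F n
        (((F.mapHomologicalComplex (ComplexShape.down ℕ)).map g.hom).f n ≫ φ) hφ' := by
  have hg : g.hom.f 0 ≫ P'.π.f 0 = P.π.f 0 ≫ f := by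
    rw [g.hom_f_zero_comp_π_f_zero, ChainComplex.single₀_map_f_zero]
    rfl
  unfold leftDerivedDesc
  rw [ProjectiveResolution.isoLeftDerivedObj_hom_naturality_assoc f P P' g.hom hg F n]
  exact congrArg (fun z => (P.isoLeftDerivedObj F n).hom ≫ z)
    (homologyMap_comp_homologyDesc _ n φ hφ hφ')

theorem leftDerived_app_comp_desc {F G : C ⥤ D} [F.Additive] [G.Additive] (α : F ⟶ G) {X : C}
    (P : ProjectiveResolution X) (n : ℕ) {A : D} (φ : (derivedComplex P G).X n ⟶ A)
    (hφ : (derivedComplex P G).d (n + 1) n ≫ φ = 0)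
    (hφ' : (derivedComplex P F).d (n + 1) n ≫
      ((NatTrans.mapHomologicalComplex α (ComplexShape.down ℕ)).app P.complex).f n ≫ φ = 0) :
    (NatTrans.leftDerived α n).app X ≫ leftDerivedDesc P G n φ hφ =
      leftDerivedDesc P F n
        (((NatTrans.mapHomologicalComplex α (ComplexShape.down ℕ)).app P.complex).f n ≫ φ) hφ' := by
  unfold leftDerivedDesc
  rw [P.leftDerived_app_eq α n, Category.assoc, Category.assoc, Iso.inv_hom_id_assoc]
  exact congrArg (fun z => (P.isoLeftDerivedObj F n).hom ≫ z)
    (homologyMap_comp_homologyDesc _ n φ hφ hφ')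

theorem leftDerivedDesc_eq_zero_iff {X : C} (P : ProjectiveResolution X) (F : C ⥤ D) [F.Additive]
    (n : ℕ) {A : D} [Injective A] (φ : (derivedComplex P F).X n ⟶ A)
    (hφ : (derivedComplex P F).d (n + 1) n ≫ φ = 0) :
    leftDerivedDesc P F n φ hφ = 0 ↔
      ∃ ψ : (derivedComplex P F).X ((ComplexShape.down ℕ).next n) ⟶ A,
        (derivedComplex P F).d n _ ≫ ψ = φ := by
  rw [← homologyDesc_eq_zero_iff (derivedComplex P F) n φ hφ]
  unfold leftDerivedDesc
  refine ⟨fun h => ?_, fun h => ?_⟩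
  · exact (cancel_epi (P.isoLeftDerivedObj F n).hom).mp (h.trans Limits.comp_zero.symm)
  · exact (congrArg (fun z => (P.isoLeftDerivedObj F n).hom ≫ z) h).trans Limits.comp_zero

end LeftDerived

/-! ### Comparison of the two definitions of `Ext` -/

section Compare

/-- The form with `next` covers degree 0 as well: there `next 0 = 0` and the differential is zero,
so the condition says that f vanishes. -/
theorem extMk_eq_zero_iff_exists_next {C : Type*} [Category C] [Abelian C] [HasExt C]
    {X Y : C} (P : ProjectiveResolution X) {n : ℕ} (f : P.complex.X n ⟶ Y)
    (hf : P.complex.d (n + 1) n ≫ f = 0) :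
    P.extMk f (n + 1) rfl hf = 0 ↔
      ∃ g : P.complex.X ((ComplexShape.down ℕ).next n) ⟶ Y, P.complex.d n _ ≫ g = f := by
  cases n with
  | zero =>
    rw [← P.extEquivCohomologyClass.apply_eq_iff_eq, P.extEquivCohomologyClass_extMk,
      P.extEquivCohomologyClass_zero, CochainComplex.HomComplex.CohomologyClass.mk_eq_zero_iff,
      CochainComplex.HomComplex.Cocycle.toSingleMk_mem_coboundaries_iff _ _ _ _ _ 1 (by simp)]
    have hz : Limits.IsZero (P.cochainComplex.X 1) := by
      exact CochainComplex.isZero_of_isStrictlyLE _ 0 _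
    constructor
    · rintro ⟨g, hg⟩
      rw [hz.eq_zero_of_src g, Limits.comp_zero] at hg
      refine ⟨0, ?_⟩
      rw [Limits.comp_zero]
      exact ((cancel_epi _).mp (hg.symm.trans Limits.comp_zero.symm)).symm
    · rintro ⟨g, rfl⟩
      refine ⟨0, ?_⟩
      simp
  | succ p =>
    have h : (ComplexShape.down ℕ).next (p + 1) = p := by simp
    rw [P.extMk_eq_zero_iff f (p + 2) rfl hf p rfl, h]

variable {R : Type u} [CommRing R]

/-- A morphism `Z ⟶ Y` as a morphism from `R` to the module of all such morphisms. -/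
noncomputable def yonedaElement {Z Y : ModuleCat.{u} R} (f : Z ⟶ Y) :
    ModuleCat.of R R ⟶ ((linearYoneda R (ModuleCat.{u} R)).obj Y).obj (Opposite.op Z) :=
  ModuleCat.ofHom (LinearMap.toSpanSingleton R (Z ⟶ Y) f)

theorem yonedaElement_comp_map {Z Z' Y : ModuleCat.{u} R} (f : Z ⟶ Y) (h : Z' ⟶ Z) :
    yonedaElement f ≫ ((linearYoneda R (ModuleCat.{u} R)).obj Y).map h.op =
      yonedaElement (h ≫ f) := by
  apply ModuleCat.hom_ext
  apply LinearMap.ext_ring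
  change h ≫ ((1 : R) • f) = (1 : R) • (h ≫ f)
  simp

theorem yonedaElement_comp_app {Z Y Y' : ModuleCat.{u} R} (f : Z ⟶ Y) (g : Y ⟶ Y') :
    yonedaElement f ≫ ((linearYoneda R (ModuleCat.{u} R)).map g).app (Opposite.op Z) =
      yonedaElement (f ≫ g) := by
  apply ModuleCat.hom_ext
  apply LinearMap.ext_ring
  change ((1 : R) • f) ≫ g = (1 : R) • (f ≫ g)
  simp

theorem yonedaElement_injective {Z Y : ModuleCat.{u} R} {f g : Z ⟶ Y}
    (h : yonedaElement f = yonedaElement g) : f = g := by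
  have h1 : (1 : R) • f = (1 : R) • g :=
    congrArg (fun ψ : ModuleCat.of R R ⟶ ((linearYoneda R (ModuleCat.{u} R)).obj Y).obj
      (Opposite.op Z) => ψ.hom (1 : R)) h
  simpa using h1

theorem exists_eq_yonedaElement {Z Y : ModuleCat.{u} R}
    (ψ : ModuleCat.of R R ⟶ ((linearYoneda R (ModuleCat.{u} R)).obj Y).obj (Opposite.op Z)) :
    ∃ f : Z ⟶ Y, ψ = yonedaElement f := by
  refine ⟨ψ.hom (1 : R), ?_⟩
  apply ModuleCat.hom_ext
  apply LinearMap.ext_ring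
  exact (one_smul R _).symm

/-- The functor whose left derived functors are, up to passing to opposites, `Ext` with values
in `Y`. -/
noncomputable abbrev yonedaOp (Y : ModuleCat.{u} R) : ModuleCat.{u} R ⥤ (ModuleCat.{u} R)ᵒᵖ :=
  ((linearYoneda R (ModuleCat.{u} R)).obj Y).rightOp

theorem d_comp_yonedaElement_op {X Y : ModuleCat.{u} R} (P : ProjectiveResolution X) {m n : ℕ}
    (f : P.complex.X n ⟶ Y) :
    (derivedComplex P (yonedaOp Y)).d m n ≫ (yonedaElement f).op =
      (yonedaElement (P.complex.d m n ≫ f)).op :=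
  congrArg Quiver.Hom.op (yonedaElement_comp_map f (P.complex.d m n))

theorem yonedaElement_zero (Z Y : ModuleCat.{u} R) : yonedaElement (0 : Z ⟶ Y) = 0 := by
  apply ModuleCat.hom_ext
  apply LinearMap.ext_ring
  change (1 : R) • (0 : Z ⟶ Y) = 0
  exact smul_zero _

theorem d_comp_yonedaElement_op_eq_zero {X Y : ModuleCat.{u} R} (P : ProjectiveResolution X)
    {n : ℕ} {f : P.complex.X n ⟶ Y} (hf : P.complex.d (n + 1) n ≫ f = 0) :
    (derivedComplex P (yonedaOp Y)).d (n + 1) n ≫ (yonedaElement f).op = 0 := by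
  rw [d_comp_yonedaElement_op, hf, yonedaElement_zero]
  rfl

/-- The element of `Ext` given by a cocycle on a projective resolution. -/
noncomputable def extClass {X Y : ModuleCat.{u} R} (P : ProjectiveResolution X) {n : ℕ}
    (f : P.complex.X n ⟶ Y) (hf : P.complex.d (n + 1) n ≫ f = 0) :
    ((_root_.Ext R (ModuleCat.{u} R) n).obj (Opposite.op X)).obj Y :=
  (leftDerivedDesc P (yonedaOp Y) n (yonedaElement f).op
    (d_comp_yonedaElement_op_eq_zero P hf)).unop.hom (1 : R)

/-- Elements of `Ext` are treated as maps from R, that is, as maps to its opposite from a left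
derived functor; injectivity of this target lets `leftDerivedDesc_eq_zero_iff` apply. -/
instance : Injective (Opposite.op (ModuleCat.of.{u} R R)) := by
  have : Projective (ModuleCat.of.{u} R R) :=
    (IsProjective.iff_projective R).mp inferInstance
  infer_instance

/-- Both classes vanish exactly when the cocycle is a coboundary on the chosen resolution, so no
isomorphism between the two versions of Ext is needed. -/
theorem extClass_eq_zero_iff {X Y : ModuleCat.{u} R} (P : ProjectiveResolution X) {n : ℕ}
    (f : P.complex.X n ⟶ Y) (hf : P.complex.d (n + 1) n ≫ f = 0) :
    extClass P f hf = 0 ↔ P.extMk f (n + 1) rfl hf = 0 := by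
  rw [extMk_eq_zero_iff_exists_next]
  have h1 : extClass P f hf = 0 ↔ leftDerivedDesc P (yonedaOp Y) n (yonedaElement f).op
      (d_comp_yonedaElement_op_eq_zero P hf) = 0 := by
    constructor
    · intro h
      apply Quiver.Hom.unop_inj
      apply ModuleCat.hom_ext
      apply LinearMap.ext_ring
      exact h
    · intro h
      unfold extClass
      rw [h]
      rfl
  refine h1.trans ((leftDerivedDesc_eq_zero_iff P (yonedaOp Y) n _ _).trans ?_)
  constructor
  · rintro ⟨ψ, hψ⟩
    obtain ⟨g, hg⟩ := exists_eq_yonedaElement (Z := P.complex.X _) (Y := Y) ψ.unop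
    refine ⟨g, yonedaElement_injective (Quiver.Hom.op_inj ?_)⟩
    rw [← d_comp_yonedaElement_op, ← hψ, ← hg]
    rfl
  · rintro ⟨g, rfl⟩
    exact ⟨(yonedaElement g).op, d_comp_yonedaElement_op P g⟩

theorem map_extClass {X Y Y' : ModuleCat.{u} R} (P : ProjectiveResolution X) {n : ℕ}
    (f : P.complex.X n ⟶ Y) (hf : P.complex.d (n + 1) n ≫ f = 0) (g : Y ⟶ Y')
    (hg : P.complex.d (n + 1) n ≫ f ≫ g = 0) :
    (((_root_.Ext R (ModuleCat.{u} R) n).obj (Opposite.op X)).map g).hom (extClass P f hf) =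
      extClass P (f ≫ g) hg := by
  have h0 : ((NatTrans.mapHomologicalComplex
      (NatTrans.rightOp ((linearYoneda R (ModuleCat.{u} R)).map g))
      (ComplexShape.down ℕ)).app P.complex).f n ≫ (yonedaElement f).op =
      (yonedaElement (f ≫ g)).op :=
    congrArg Quiver.Hom.op (yonedaElement_comp_app f g)
  have h1 := leftDerived_app_comp_desc (NatTrans.rightOp ((linearYoneda R (ModuleCat.{u} R)).map g))
    P n (yonedaElement f).op (d_comp_yonedaElement_op_eq_zero P hf) (by
      rw [h0]; exact d_comp_yonedaElement_op_eq_zero P hg)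
  simp only [h0] at h1
  exact congrArg (fun z : ((yonedaOp Y').leftDerived n).obj X ⟶ Opposite.op (ModuleCat.of R R) =>
    z.unop.hom (1 : R)) h1

theorem map_op_extClass {X X' Y : ModuleCat.{u} R} (h : X ⟶ X') (P : ProjectiveResolution X)
    (P' : ProjectiveResolution X') (φ : ProjectiveResolution.Hom P P' h) {n : ℕ}
    (f : P'.complex.X n ⟶ Y) (hf : P'.complex.d (n + 1) n ≫ f = 0)
    (hf' : P.complex.d (n + 1) n ≫ φ.hom.f n ≫ f = 0) :
    (((_root_.Ext R (ModuleCat.{u} R) n).map h.op).app Y).hom (extClass P' f hf) =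
      extClass P (φ.hom.f n ≫ f) hf' := by
  have h0 : (((yonedaOp Y).mapHomologicalComplex (ComplexShape.down ℕ)).map φ.hom).f n ≫
      (yonedaElement f).op = (yonedaElement (φ.hom.f n ≫ f)).op :=
    congrArg Quiver.Hom.op (yonedaElement_comp_map f (φ.hom.f n))
  have h1 := leftDerived_map_comp_desc h P P' φ (yonedaOp Y) n (yonedaElement f).op
    (d_comp_yonedaElement_op_eq_zero P' hf) (by
      rw [h0]; exact d_comp_yonedaElement_op_eq_zero P hf')
  simp only [h0] at h1
  exact congrArg (fun z : ((yonedaOp Y).leftDerived n).obj X ⟶ Opposite.op (ModuleCat.of R R) =>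
    z.unop.hom (1 : R)) h1

end Compare

end FSing

namespace FSing

open Abelian RingTheory.Sequence IsLocalRing

/-! ### Local cohomology classes -/

section LocalCohomology

variable {R : Type u} [CommRing R]

/-- The transition map `R ⧸ J ^ n ⟶ R ⧸ J ^ N`. -/
def powTransition (J : Ideal R) {N n : ℕ} (h : N ≤ n) :
    ModuleCat.of R (R ⧸ J ^ n) ⟶ ModuleCat.of R (R ⧸ J ^ N) :=
  ModuleCat.ofHom (Submodule.mapQ _ _ LinearMap.id (Ideal.pow_le_pow_right h))

/-- Evaluation preserves the colimit and filtered colimits of modules are computed on underlying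
sets, so an element dies in the colimit only if it dies at a finite stage. -/
theorem colimit_ι_app_eq_zero_iff {K : Type} [SmallCategory K] [IsFiltered K]
    {A : Type*} [Category A] (D : K ⥤ A ⥤ ModuleCat.{u} R) [Limits.HasColimit D] (k : K) (Q : A)
    (x : (D.obj k).obj Q) : ((Limits.colimit.ι D k).app Q).hom x = 0 ↔
      ∃ (k' : K) (f : k ⟶ k'), ((D.map f).app Q).hom x = 0 := by
  have : Limits.PreservesFilteredColimitsOfSize.{0, 0} (forget (ModuleCat.{u} R)) :=
    Limits.preservesSmallestFilteredColimits_of_preservesFilteredColimits.{u, u} _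
  have hc := Limits.isColimitOfPreserves ((evaluation A (ModuleCat.{u} R)).obj Q)
    (Limits.colimit.isColimit D)
  constructor
  · intro h
    obtain ⟨k', f, g, hfg⟩ := Limits.Concrete.isColimit_exists_of_rep_eq _ hc (i := k) (j := k)
      x 0 (by
        refine Eq.trans h ?_
        exact (map_zero ((Limits.colimit.ι D k).app Q).hom).symm)
    refine ⟨k', f, hfg.trans ?_⟩
    exact map_zero ((D.map g).app Q).hom
  · rintro ⟨k', f, hf⟩
    have h1 : (D.map f).app Q ≫ (Limits.colimit.ι D k').app Q = (Limits.colimit.ι D k).app Q := by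
      rw [← NatTrans.comp_app, Limits.colimit.w]
    rw [← h1, ModuleCat.hom_comp, LinearMap.comp_apply, hf, map_zero]

/-- A class in `Ext (R ⧸ J ^ N) M d` gives a local cohomology class whose images vanish exactly if
the corresponding extension class vanishes after restriction to some `R ⧸ J ^ n`. -/
theorem exists_localCohomology_class (J : Ideal R) (d N : ℕ) {M : ModuleCat.{u} R}
    (e : Abelian.Ext (ModuleCat.of R (R ⧸ J ^ N)) M d) :
    ∃ ξ : (localCohomology J d).obj M, ∀ (Q : ModuleCat.{u} R) (φ : M ⟶ Q),
      ((localCohomology J d).map φ).hom ξ = 0 ↔ ∃ (n : ℕ) (h : N ≤ n),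
        (Ext.mk₀ (powTransition J h)).comp (e.comp (Ext.mk₀ φ) (add_zero d)) (zero_add d) = 0 := by
  let P := fun n => projectiveResolution (ModuleCat.of R (R ⧸ J ^ n))
  obtain ⟨f, hf, rfl⟩ := (P N).extMk_surjective e (d + 1) rfl
  let D := localCohomology.diagram (localCohomology.idealPowersDiagram J) d
  have : Limits.HasColimit D := localCohomology.hasColimitDiagram _ _
  let k : ℕ → ℕᵒᵖᵒᵖ := fun n => Opposite.op (Opposite.op n)
  refine ⟨((Limits.colimit.ι D (k N)).app M).hom (extClass (P N) f hf), fun Q φ => ?_⟩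
  have hfφ : (P N).complex.d (d + 1) d ≫ f ≫ φ = 0 := by
    rw [← Category.assoc, hf, Limits.zero_comp]
  have h1 : ((localCohomology J d).map φ).hom
      (((Limits.colimit.ι D (k N)).app M).hom (extClass (P N) f hf)) =
      ((Limits.colimit.ι D (k N)).app Q).hom (extClass (P N) (f ≫ φ) hfφ) := by
    have h2 := congrArg (fun z => z.hom (extClass (P N) f hf))
      ((Limits.colimit.ι D (k N)).naturality φ)
    refine h2.symm.trans ?_
    exact congrArg ((Limits.colimit.ι D (k N)).app Q).hom (map_extClass (P N) f hf φ hfφ)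
  have h3 : ∀ (n : ℕ) (h : N ≤ n) (g : k N ⟶ k n),
      ((D.map g).app Q).hom (extClass (P N) (f ≫ φ) hfφ) = 0 ↔
        (Ext.mk₀ (powTransition J h)).comp
          (((P N).extMk f (d + 1) rfl hf).comp (Ext.mk₀ φ) (add_zero d)) (zero_add d) = 0 := by
    intro n h g
    let ψ : ProjectiveResolution.Hom (P n) (P N) (powTransition J h) :=
      { hom := ProjectiveResolution.lift (powTransition J h) (P n) (P N)
        hom_f_zero_comp_π_f_zero := by
          rw [← HomologicalComplex.comp_f, ProjectiveResolution.lift_commutes,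
            HomologicalComplex.comp_f] }
    have h5 : (P n).complex.d (d + 1) d ≫ ψ.hom.f d ≫ f ≫ φ = 0 := by
      rw [← ψ.hom.comm_assoc, hfφ, Limits.comp_zero]
    have h4 := map_op_extClass (powTransition J h) (P n) (P N) ψ (f ≫ φ) hfφ h5
    have h6 : ((D.map g).app Q).hom (extClass (P N) (f ≫ φ) hfφ) =
      extClass (P n) (ψ.hom.f d ≫ f ≫ φ) h5 := h4
    rw [(P N).extMk_comp_mk₀, ProjectiveResolution.mk₀_comp_extMk _ _ _ _ ψ,
      ← extClass_eq_zero_iff]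
    exact Eq.congr_left h6
  refine (Eq.congr_left h1).trans ((colimit_ι_app_eq_zero_iff D (k N) Q _).trans ?_)
  constructor
  · rintro ⟨k', g, hg⟩
    have h : N ≤ k'.unop.unop := g.unop.unop.down.down
    exact ⟨k'.unop.unop, h, (h3 _ h g).mp hg⟩
  · rintro ⟨n, h, hn⟩
    have g : k N ⟶ k n := (homOfLE h).op.op
    exact ⟨k n, g, (h3 n h g).mpr hn⟩

end LocalCohomology

end FSing

namespace FSing

open Abelian RingTheory.Sequence IsLocalRing

/-! ### `F`-injective Gorenstein rings are `F`-pure -/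

section FPure

variable {R : Type u} [CommRing R]

/-- Multiplication by an element of `Q` as a morphism `R ⟶ Q`. -/
def spanMap {Q : ModuleCat.{u} R} (q : Q) : ModuleCat.of R R ⟶ Q :=
  ModuleCat.ofHom (LinearMap.toSpanSingleton R Q q)

/-- An extension class killed by `I` is killed by maps `R ⟶ Q` with image in `I Q`. -/
theorem ext_comp_spanMap_eq_zero {X : ModuleCat.{u} R} {d : ℕ} {I : Ideal R}
    (e : Abelian.Ext X (ModuleCat.of R R) d) (he : ∀ r ∈ I, r • e = 0) {Q : ModuleCat.{u} R} {q : Q}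
    (hq : q ∈ I • (⊤ : Submodule R Q)) :
    e.comp (Ext.mk₀ (spanMap q)) (add_zero d) = 0 := by
  refine Submodule.smul_induction_on (p := fun q =>
    e.comp (Ext.mk₀ (spanMap q)) (add_zero d) = 0) hq ?_ ?_
  · intro r hr n _
    have h : spanMap (r • n) = r • spanMap n := by
      apply ModuleCat.hom_ext
      apply LinearMap.ext_ring
      simp [spanMap]
    rw [h, Ext.mk₀_smul, Ext.comp_smul, ← Ext.smul_comp, he r hr, Ext.zero_comp]
  · intro n n' hn hn'
    have h : spanMap (n + n') = spanMap n + spanMap n' := by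
      apply ModuleCat.hom_ext
      apply LinearMap.ext_ring
      simp [spanMap]
    rw [h, Ext.mk₀_add, Ext.comp_add, hn, hn', add_zero]

/-- If `X ⟶ Z` is surjective and `rs` is a regular sequence killing `X`, then `Ext Z R` embeds in
`Ext X R` in degree the length of `rs`. -/
theorem eq_zero_of_mk₀_comp_eq_zero {rs : List R} (reg : IsWeaklyRegular R rs)
    {d : ℕ} (hd : rs.length = d) {X Z : ModuleCat.{u} R} (hX : ∀ r ∈ rs, ∀ n : X, r • n = 0) (π : X ⟶ Z)
    (hπ : Function.Surjective π.hom) (x : Abelian.Ext Z (ModuleCat.of R R) d)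
    (hx : (Ext.mk₀ π).comp x (zero_add _) = 0) : x = 0 := by
  have hvan := (exists_universal_ext (ModuleCat.of R R) rs reg).1
  rw [hd] at hvan
  cases d with
  | zero =>
    have : Epi π := (ModuleCat.epi_iff_surjective π).mpr hπ
    exact Ext.precomp_mk₀_injective_of_epi (ModuleCat.of R R) π
      (hx.trans (map_zero _).symm)
  | succ d =>
    let S : ShortComplex (ModuleCat.{u} R) :=
      ShortComplex.mk (ModuleCat.ofHom (LinearMap.ker π.hom).subtype) π (by
        ext a
        exact a.2)
    have hS : S.ShortExact := ModuleCat.shortComplex_shortExact S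
      (fun a => ⟨fun h => ⟨⟨a, h⟩, rfl⟩, by rintro ⟨b, rfl⟩; exact b.2⟩)
      Subtype.val_injective hπ
    obtain ⟨y, rfl⟩ := Ext.contravariant_sequence_exact₃ hS (ModuleCat.of R R) x hx
      (Nat.add_comm 1 d)
    -- The kernel of π is a submodule of X, hence also killed by `rs`, so its Ext vanishes below
    -- degree `rs.length`.
    have : Subsingleton (Abelian.Ext S.X₁ (ModuleCat.of R R) d) :=
      hvan S.X₁ (fun r hr n => Subtype.ext (hX r hr n.1)) d (Nat.lt_succ_self d)
    rw [Subsingleton.elim y 0, Ext.comp_zero]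

variable [IsLocalRing R] [IsNoetherianRing R]

/-- A system of parameters `x` in a Gorenstein ring is the annihilator of a local cohomology
class of `R`. -/
theorem IsGorensteinLocal.exists_localCohomology_annihilator (hR : IsGorensteinLocal R) {d : ℕ}
    {x : Fin d → R} (hx : IsSystemOfParameters R x) :
    ∃ ξ : (localCohomology (maximalIdeal R) d).obj (ModuleCat.of R R),
      (∀ (Q : ModuleCat.{u} R) (q : Q), q ∈ Ideal.span (Set.range x) • (⊤ : Submodule R Q) →
        ((localCohomology (maximalIdeal R) d).map (spanMap q)).hom ξ = 0) ∧
      ∀ r : R, ((localCohomology (maximalIdeal R) d).map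
        (spanMap (Q := ModuleCat.of R R) r)).hom ξ = 0 → r ∈ Ideal.span (Set.range x) := by
  obtain ⟨reg, -⟩ := hR.isRegular_of_isSystemOfParameters hx
  have huniv := (exists_universal_ext (ModuleCat.of R R) (List.ofFn x) reg.toIsWeaklyRegular).2
  have hI : Ideal.ofList (List.ofFn x) = Ideal.span (Set.range x) := ofList_ofFn x
  have hsm : Ideal.ofList (List.ofFn x) • (⊤ : Submodule R (ModuleCat.of R R)) =
      Ideal.span (Set.range x) := by
    rw [hI]
    exact Ideal.mul_top _
  set Z : ModuleCat.{u} R := ModuleCat.of R (ModuleCat.of R R ⧸ Ideal.ofList (List.ofFn x) •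
    (⊤ : Submodule R (ModuleCat.of R R))) with hZ
  have hkill : ∀ r ∈ Ideal.span (Set.range x), ∀ z : Z, r • z = 0 := by
    intro r hr z
    obtain ⟨a, rfl⟩ := Submodule.Quotient.mk_surjective _ z
    rw [← Submodule.Quotient.mk_smul, Submodule.Quotient.mk_eq_zero, hsm]
    exact Ideal.mul_mem_right _ _ hr
  obtain ⟨η, hη⟩ : ∃ η : Abelian.Ext Z (ModuleCat.of R R) d,
      ∀ φ : Z ⟶ Z, (Ext.mk₀ φ).comp η (zero_add _) = 0 → φ = 0 := by
    have hZx : ∀ r ∈ List.ofFn x, ∀ z : Z, r • z = 0 := fun r hr z =>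
      hkill r (Ideal.subset_span ((List.mem_ofFn' x r).mp hr)) z
    rw [List.length_ofFn] at huniv
    obtain ⟨η, hη⟩ := huniv
    refine ⟨η, fun φ hφ => (hη Z hZx).1 (hφ.trans ?_)⟩
    simp
  obtain ⟨N, hN⟩ : ∃ N, maximalIdeal R ^ N ≤ Ideal.span (Set.range x) := by
    rw [← hx.2]
    exact Ideal.exists_radical_pow_le_of_fg _ (IsNoetherian.noetherian _)
  let π : ModuleCat.of R (R ⧸ maximalIdeal R ^ N) ⟶ Z :=
    ModuleCat.ofHom (Submodule.mapQ _ _ (LinearMap.id : R →ₗ[R] R) (by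
      rw [hsm]
      exact hN))
  obtain ⟨ξ, hξ⟩ := exists_localCohomology_class (maximalIdeal R) d N
    ((Ext.mk₀ π).comp η (zero_add d))
  refine ⟨ξ, fun Q q hq => (hξ Q _).mpr ⟨N, le_rfl, ?_⟩, fun r hr => ?_⟩
  · rw [ext_comp_spanMap_eq_zero _ (fun r hr => ?_) hq, Ext.comp_zero]
    rw [← Ext.comp_smul, smul_ext_eq_zero (hkill r hr), Ext.comp_zero]
  · obtain ⟨n, hNn, hn⟩ := (hξ _ _).mp hr
    -- R/𝔪ⁿ is killed by the regular sequence of (n + 1)-st powers, so restriction of Ext^d along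
    -- R/𝔪ⁿ → R/(x) is injective and nothing is lost in the colimit. The exponent n + 1 is nonzero
    -- even when n = 0.
    obtain ⟨reg', -⟩ := hR.isRegular_of_isSystemOfParameters (hx.pow n.succ_ne_zero)
    rw [Ext.comp_assoc _ _ _ (zero_add d) (add_zero d) (by simp),
      Ext.mk₀_comp_mk₀_assoc] at hn
    have h1 : η.comp (Ext.mk₀ (spanMap (Q := ModuleCat.of R R) r)) (add_zero d) = 0 := by
      refine eq_zero_of_mk₀_comp_eq_zero reg'.toIsWeaklyRegular List.length_ofFn ?_
        (powTransition (maximalIdeal R) hNn ≫ π) ?_ _ hn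
      · intro s hs a
        obtain ⟨i, rfl⟩ := (List.mem_ofFn' _ _).mp hs
        obtain ⟨a, rfl⟩ := Submodule.Quotient.mk_surjective _ a
        rw [← Submodule.Quotient.mk_smul, Submodule.Quotient.mk_eq_zero]
        have hxi : x i ∈ maximalIdeal R := by
          rw [← hx.2]
          exact Ideal.le_radical (Ideal.subset_span (Set.mem_range_self i))
        exact Ideal.mul_mem_right _ _
          (Ideal.pow_le_pow_right n.le_succ (Ideal.pow_mem_pow hxi (n + 1)))
      · intro z
        obtain ⟨a, rfl⟩ := Submodule.Quotient.mk_surjective _ z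
        exact ⟨Submodule.Quotient.mk (p := maximalIdeal R ^ n) a, rfl⟩
    have h2 : spanMap (Q := ModuleCat.of R R) r = r • 𝟙 (ModuleCat.of R R) := by
      apply ModuleCat.hom_ext
      apply LinearMap.ext_ring
      simp [spanMap]
    have h3 : (Ext.mk₀ (r • 𝟙 Z)).comp η (zero_add d) = 0 := by
      rw [h2, Ext.mk₀_smul, Ext.comp_smul, Ext.comp_mk₀_id] at h1
      rw [Ext.mk₀_smul, Ext.smul_comp, Ext.mk₀_id_comp, h1]
    have h4 : r • (Submodule.Quotient.mk (1 : R) : Z) = 0 :=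
      congrArg (fun φ : Z ⟶ Z => φ.hom (Submodule.Quotient.mk (1 : R))) (hη _ h3)
    rw [← Submodule.Quotient.mk_smul, Submodule.Quotient.mk_eq_zero, hsm] at h4
    simpa using h4

/-- In an `F`-injective Gorenstein local ring, ideals generated by systems of parameters are
Frobenius closed. -/
theorem IsGorensteinLocal.mem_of_frobeniusLinear_mem (hR : IsGorensteinLocal R) (p : ℕ)
    [Fact p.Prime] [CharP R p] (hF : IsFInjective p R) {d : ℕ} {x : Fin d → R}
    (hx : IsSystemOfParameters R x) {a : R}
    (ha : frobeniusLinear p R a ∈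
      Ideal.span (Set.range x) • (⊤ : Submodule R (FrobeniusPushforward p R))) :
    a ∈ Ideal.span (Set.range x) := by
  obtain ⟨ξ, h1, h2⟩ := hR.exists_localCohomology_annihilator hx
  apply h2
  -- By F-injectivity vanishing may be tested in F_*R, where the map from R becomes 1 ↦ F(a) ∈
  -- (x)F_*R and so kills ξ.
  apply hF d
  rw [map_zero, ← LinearMap.comp_apply, ← ModuleCat.hom_comp, ← Functor.map_comp]
  have h3 : spanMap (Q := ModuleCat.of R R) a ≫ ModuleCat.ofHom (frobeniusLinear p R) =
      spanMap (Q := ModuleCat.of R (FrobeniusPushforward p R)) (frobeniusLinear p R a) := by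
    apply ModuleCat.hom_ext
    apply LinearMap.ext_ring
    simp [spanMap]
  rw [h3]
  exact h1 (ModuleCat.of R (FrobeniusPushforward p R)) _ ha

/-- For Gorenstein local rings, `F`-injective implies `F`-pure. -/
theorem IsGorensteinLocal.isFPure (hR : IsGorensteinLocal R) (p : ℕ) [Fact p.Prime] [CharP R p]
    (hF : IsFInjective p R) : IsFPure p R := by
  intro M _ _
  rw [injective_iff_map_eq_zero]
  intro z hz
  obtain ⟨m, rfl⟩ := (TensorProduct.rid R M).symm.surjective z
  rw [TensorProduct.rid_symm_apply, LinearMap.lTensor_tmul] at hz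
  rw [TensorProduct.rid_symm_apply]
  by_contra hm
  have hm0 : m ≠ 0 := by
    rintro rfl
    simp at hm
  have hmem : m ∈ Submodule.span R {m} := Submodule.mem_span_singleton_self m
  -- The relation m ⊗ F(1) = 0 already holds in a finitely generated submodule M', where maps to
  -- R/(xᵗ) detect m.
  obtain ⟨M', hle, hfg, h0⟩ := TensorProduct.eq_zero_of_fg_of_subtype_eq_zero
    (Submodule.fg_span_singleton m)
    (t := (⟨m, hmem⟩ : Submodule.span R {m}) ⊗ₜ[R] frobeniusLinear p R 1) (by
      rw [LinearMap.rTensor_tmul]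
      exact hz)
  rw [LinearMap.rTensor_tmul] at h0
  have : Module.Finite R M' := Module.Finite.iff_fg.mpr hfg
  obtain ⟨d, x, hx⟩ := hR.exists_isSystemOfParameters
  obtain ⟨t, ht, g, hg⟩ := hR.exists_linearMap_quotient_pow hx (Set.Ioi_infinite 0) M'
    (m := Submodule.inclusion hle ⟨m, hmem⟩) (fun h => hm0 (congrArg Subtype.val h))
  obtain ⟨a, ha⟩ := Ideal.Quotient.mk_surjective (g (Submodule.inclusion hle ⟨m, hmem⟩))
  have h1 := congrArg (g.rTensor (FrobeniusPushforward p R)) h0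
  rw [LinearMap.rTensor_tmul, map_zero, ← ha] at h1
  -- Under (R/(xᵗ)) ⊗ F_*R ≅ F_*R/(xᵗ)F_*R the relation reads F(a) ∈ (xᵗ)F_*R.
  have h2 := congrArg (TensorProduct.quotTensorEquivQuotSMul (FrobeniusPushforward p R) _) h1
  rw [TensorProduct.quotTensorEquivQuotSMul_mk_tmul, map_zero, Submodule.Quotient.mk_eq_zero,
    ← map_smul, smul_eq_mul, mul_one] at h2
  have h3 := hR.mem_of_frobeniusLinear_mem p hF (hx.pow (Nat.pos_iff_ne_zero.mp ht)) h2
  exact hg (ha.symm.trans (Ideal.Quotient.eq_zero_iff_mem.mpr h3))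

end FPure

end FSing

/-! ### The four statements together -/

theorem mainTheorem7 (R : Type u) [CommRing R] [IsLocalRing R] [IsNoetherianRing R]
    [IsAdicComplete (IsLocalRing.maximalIdeal R) R] (hR : FSing.IsGorensteinLocal R) :
    -- functorial residual closure operations closing the powers of a system of parameters
    (∀ c : FSing.ClosureOperation R, c.Functorial → c.Residual →
      ∀ (d : ℕ) (x : Fin d → R), FSing.IsSystemOfParameters R x →
        {t : ℕ | c.cl R (Ideal.span (Set.range fun i => x i ^ t)) =
          Ideal.span (Set.range fun i => x i ^ t)}.Infinite →
        (∀ I : Ideal R, c.cl R I = I) ∧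
        ∀ (M : Type u) [AddCommGroup M] [Module R M] [Module.Finite R M],
          c.cl M (⊥ : Submodule R M) = ⊥) ∧
    -- equicharacteristic and `F`-rational implies `F`-regular: characteristic `p`
    (∀ (p : ℕ) [Fact p.Prime] [CharP R p], FSing.IsFRational p R → FSing.IsFRegular p R) ∧
    -- the same in equal characteristic zero
    (∀ (K : Type v) [Field K] [CharZero K] [Algebra K R],
      FSing.IsFRationalZero K R → FSing.IsFRegularZero K R) ∧
    -- `F`-injective implies `F`-pure
    (∀ (p : ℕ) [Fact p.Prime] [CharP R p], FSing.IsFInjective p R → FSing.IsFPure p R) :=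
  ⟨fun c hf hr _ _ hx hT => hR.closureOperation_trivial c hf hr hx hT,
    fun p _ _ h => hR.isFRegular p h,
    fun K _ _ _ h => hR.isFRegularZero K h,
    fun p _ _ h => hR.isFPure p h⟩
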